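/- Let $G'$ be a simple graph on $N\ge 3$ nodes (the clean graph) with degrees $d'_1,\dots,d'_N$ and $m'$ edges, and let $\lambda'_1\le\lambda'_2\le\dots\le\lambda'_N$ be the eigenvalues, with multiplicity, of its Laplacian $L'=D'-A'$. For $q\in[0,1]$ let the noisy graph $G$ be obtained from $G'$ by removing each edge independently with probability $q$. For every graph on these $N$ nodes fix a unit eigenvector of its Laplacian for the second smallest eigenvalue (any choice, if it is not unique up to sign), and write $\mathbf u'_2$ and $\mathbf u_2$ for the eigenvectors chosen for $G'$ and $G$. Let $\chi,\varphi,\beta,\kappa$ be real numbers with $\sum_{i=1}^N (d'_i)^2=N^{\chi}$ and $m'=N^{\varphi}$, and assume: 1. there is a real $\epsilon\ge 2$ with $\frac{2\epsilon}{\epsilon-1}\lambda'_2<\lambda'_3$ and $\lambda'_3\ge\max\left(\frac{25}{2}\epsilon q\lambda'_N,\ \frac32\epsilon\log N\right)$, where $\log$ is the natural logarithm; 2. $q\le\frac{\lambda'_2}{\kappa N^{\beta}}$, $\beta\ge\frac12\max(\chi,\varphi)$ and $\kappa>1$. Then $\mathbb E[\sin(\angle(\mathbf u'_2,\mathbf u_2))]\le\frac1\kappa$.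 Moreover, let $(G'_n)$ be a sequence of clean graphs whose numbers of nodes $N_n$ tend to infinity, with parameters $q_n,\chi_n,\varphi_n,\beta_n,\kappa_n$ that satisfy the above assumptions for each $n$ (with $\epsilon$ allowed to depend on $n$). If for some fixed $\delta>0$ one has $\beta_n\ge\frac12\max(\chi_n,\varphi_n)+\delta$ for all $n$ (for instance, if $\chi,\varphi,\beta$ do not depend on $n$ and $\beta>\frac12\max(\chi,\varphi)$), then $\mathbb E[\sin(\angle(\mathbf u'_2,\mathbf u_2))]\to0$ as $n\to\infty$. -/

import Mathlib

open Filter Topology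

/-- The Laplacian eigenvalues `λ₁ ≤ λ₂ ≤ … ≤ λ_N` of a graph on `N` nodes, with multiplicity and in
increasing order: index `i : Fin N` (counted from `0`) gives `λ_{i+1}`. Mathlib's `eigenvalues₀`
lists the eigenvalues in decreasing order, hence the reversal. -/
noncomputable def lapEigenvalue {N : ℕ} (G : SimpleGraph (Fin N)) (i : Fin N) : ℝ :=
  open Classical in
  (G.isHermitian_lapMatrix ℝ).eigenvalues₀ (Fin.cast (Fintype.card_fin N).symm (Fin.rev i))

/-- `v` is a (unit) eigenvector `u₂` of the Laplacian of `G` for the second smallest eigenvalue.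
When `λ₂` is a multiple eigenvalue every unit vector of its eigenspace is admitted; these are exactly
the vectors that are second in some orthonormal eigenbasis ordered by increasing eigenvalues. -/
def IsSecondEigenvector {N : ℕ} (hN : 3 ≤ N) (G : SimpleGraph (Fin N))
    (v : EuclideanSpace ℝ (Fin N)) : Prop :=
  open Classical in
  ‖v‖ = 1 ∧
    Matrix.toEuclideanLin (G.lapMatrix ℝ) v = lapEigenvalue G ⟨1, by omega⟩ • v

/-- The expectation of `f` of the noisy graph, which arises from `G` by removing each edge
independently with probability `q`: the set of removed edges equals `F ⊆ E(G)` with probability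
`q ^ |F| * (1 - q) ^ (|E(G)| - |F|)`. -/
noncomputable def noisyExpectation {N : ℕ} (G : SimpleGraph (Fin N)) (q : ℝ)
    (f : SimpleGraph (Fin N) → ℝ) : ℝ :=
  open Classical in
  ∑ F ∈ G.edgeFinset.powerset,
    q ^ F.card * (1 - q) ^ (G.edgeFinset.card - F.card) * f (G.deleteEdges (F : Set (Sym2 (Fin N))))

/-- The expected sine of the angle between the second Laplacian eigenvectors of the clean graph `G`
and of its noisy version, where `u H` is the chosen second eigenvector of `H`. -/
noncomputable def expectedSinAngle {N : ℕ} (G : SimpleGraph (Fin N)) (q : ℝ)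
    (u : SimpleGraph (Fin N) → EuclideanSpace ℝ (Fin N)) : ℝ :=
  noisyExpectation G q fun H => Real.sin (InnerProductGeometry.angle (u G) (u H))

/-- The standing assumption on the clean graph `G` and on the noise level `q`: the exponents `χ`, `φ`
are given by the sum of squared degrees and by the number of edges, there is a large spectral gap
after `λ₂`, and the noise is small. -/
def SpectralGapSmallNoise {N : ℕ} (hN : 3 ≤ N) (G : SimpleGraph (Fin N)) (q χ φ β κ : ℝ) : Prop :=
  open Classical in
  (∑ i, (G.degree i : ℝ) ^ 2 = (N : ℝ) ^ χ) ∧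
  ((G.edgeFinset.card : ℝ) = (N : ℝ) ^ φ) ∧
  (∃ ε : ℝ, 2 ≤ ε ∧
    2 * ε / (ε - 1) * lapEigenvalue G ⟨1, by omega⟩ < lapEigenvalue G ⟨2, by omega⟩ ∧
    max (25 / 2 * ε * q * lapEigenvalue G ⟨N - 1, by omega⟩) (3 / 2 * ε * Real.log N)
      ≤ lapEigenvalue G ⟨2, by omega⟩) ∧
  q ≤ lapEigenvalue G ⟨1, by omega⟩ / (κ * (N : ℝ) ^ β) ∧
  1 / 2 * max χ φ ≤ β ∧
  1 < κ

/-!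
Write `L'` and `L` for the Laplacians of the clean and of the noisy graph, `W = L' - L` for the
Laplacian of the graph of removed edges, and `u` for the second eigenvector of `L'`. With
`λ₂, λ₃, λ_N` the eigenvalues of `L'`, `d` the degrees and `m` the number of edges, the claim is
reduced to `𝔼 sin ∠(u, u₂) ≤ q √(∑ d²) / λ₂`, since `N ^ β ≥ N ^ (χ / 2) = √(∑ d²)`
(`expectedSinAngle_le_of_gap`, `expectedSinAngle_le_rpow`).

*Perturbation.* If `L` is at least `(1 + g) λ₂` on the orthogonal complement of the constant vector
and of `u`, with `0 < g ≤ 1`, a Davis–Kahan argument gives `g λ₂ sin ∠(u, u₂) ≤ ‖W u‖`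
(`mul_sin_angle_le`). This needs `u₂` to be orthogonal to the constants, which can fail when the
noisy graph is disconnected; but then `‖W u‖ ≥ g λ₂` (`mul_le_norm_of_kernel`), so the bound
persists. The hypothesis on `L` holds if `‖W‖ ≤ λ₃ - (1 + g) λ₂`.

*No matrix concentration is needed.* By Anderson and Morley, `‖W‖` is at most the largest degree sum
over the ends of a removed edge. Hence `‖W‖ ≤ k + 1` unless some removed edge touches `k` other
removed edges, an event of probability at most `∑ₑ (dᵢ + dⱼ - 2 choose k) q ^ (k + 1)`, the sum
running over the edges `e = ij`. On the other hand
`𝔼 ‖W u‖ ≤ q ∑ₑ ‖Lₑ u‖ ≤ q √(2 m λ₂)`, where `Lₑ` is the Laplacian of the single edge `e`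
(`expectedSinAngle_le`).

*Comparison.* The trace gives `λ₂ + (N - 2) λ₃ ≤ 2 m ≤ √N √(∑ d²)`, and `dᵢ + 1 ≤ λ_N ≤ N` together
with `q λ_N ≤ 2 λ₃ / (25 ε)` bounds the binomial term by `tailBound`. With `ℓ = λ₃ / ε` and
`w = (λ₃ - ℓ) / 2 > λ₂` everything comes down to a scalar inequality in `N`, `ℓ` and `w`
(`hasThreshold`): a threshold `k` slightly above `ℓ` makes both contributions small enough. It
follows from Stirling's formula when `ℓ + 3 w / 20 ≥ 5.7`, and the remaining compact range of
parameters, where `5 ≤ N ≤ 34`, is covered by a few boxes on which all terms are monotone.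
-/

/-! ### The Laplacian as an operator on Euclidean space -/

open Classical in
/-- The Laplacian of `G` as a linear operator on Euclidean space. -/
noncomputable def lapOp {N : ℕ} (G : SimpleGraph (Fin N)) :
    EuclideanSpace ℝ (Fin N) →ₗ[ℝ] EuclideanSpace ℝ (Fin N) :=
  Matrix.toEuclideanLin (G.lapMatrix ℝ)

/-- The all-ones vector, which spans the trivial part of the kernel of every Laplacian. -/
noncomputable def ones (N : ℕ) : EuclideanSpace ℝ (Fin N) := WithLp.toLp 2 fun _ => 1

section Operator

variable {N : ℕ} (G : SimpleGraph (Fin N))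

open Classical in
lemma lapOp_apply (z : EuclideanSpace ℝ (Fin N)) (i : Fin N) :
    lapOp G z i = ∑ j, if G.Adj i j then z i - z j else 0 := by
  have h : lapOp G z i = ((G.lapMatrix ℝ).mulVec z.ofLp) i := rfl
  rw [h, SimpleGraph.lapMatrix_mulVec_apply, ← Finset.sum_filter, Finset.sum_sub_distrib]
  simp [SimpleGraph.neighborFinset_eq_filter, ← SimpleGraph.card_neighborFinset_eq_degree]

lemma lapOp_isSymmetric : (lapOp G).IsSymmetric := by
  classical
  have := (G.isHermitian_lapMatrix ℝ)
  exact Matrix.isSymmetric_toEuclideanLin_iff.mpr this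

lemma lapOp_ones : lapOp G (ones N) = 0 := by
  ext i
  simp [lapOp_apply, ones]

lemma inner_eq_sum (x y : EuclideanSpace ℝ (Fin N)) : inner ℝ x y = ∑ i, x i * y i := by
  simp [PiLp.inner_apply, mul_comm]

lemma norm_sq_eq_sum (x : EuclideanSpace ℝ (Fin N)) : ‖x‖ ^ 2 = ∑ i, x i ^ 2 := by
  simp [EuclideanSpace.norm_sq_eq]

open Classical in
lemma inner_lapOp_self (z : EuclideanSpace ℝ (Fin N)) :
    inner ℝ z (lapOp G z) = (∑ i, ∑ j, if G.Adj i j then (z i - z j) ^ 2 else 0) / 2 := by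
  rw [inner_eq_sum]
  have h1 : ∑ i, z i * lapOp G z i = ∑ i, ∑ j, if G.Adj i j then z i * (z i - z j) else 0 := by
    refine Finset.sum_congr rfl fun i _ => ?_
    rw [lapOp_apply, Finset.mul_sum]
    exact Finset.sum_congr rfl fun j _ => by split_ifs <;> simp
  have h2 : ∑ i, z i * lapOp G z i = ∑ i, ∑ j, if G.Adj i j then z j * (z j - z i) else 0 := by
    rw [h1, Finset.sum_comm]
    simp only [G.adj_comm]
  have h3 : ∑ i, z i * lapOp G z i + ∑ i, z i * lapOp G z i =
      ∑ i, ∑ j, if G.Adj i j then (z i - z j) ^ 2 else 0 := by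
    nth_rw 1 [h1]
    rw [h2, ← Finset.sum_add_distrib]
    refine Finset.sum_congr rfl fun i _ => ?_
    rw [← Finset.sum_add_distrib]
    refine Finset.sum_congr rfl fun j _ => ?_
    split_ifs
    · ring
    · simp
  linarith

lemma inner_lapOp_self_nonneg (z : EuclideanSpace ℝ (Fin N)) : 0 ≤ inner ℝ z (lapOp G z) := by
  classical
  rw [inner_lapOp_self]
  refine div_nonneg (Finset.sum_nonneg fun i _ => Finset.sum_nonneg fun j _ => ?_) (by norm_num)
  split_ifs <;> positivity

lemma inner_lapOp_self_le (z : EuclideanSpace ℝ (Fin N)) :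
    inner ℝ z (lapOp G z) ≤ N * ‖z‖ ^ 2 := by
  classical
  have h1 : ∑ i, ∑ j, (if G.Adj i j then (z i - z j) ^ 2 else 0) ≤
      ∑ i, ∑ j, (z i - z j) ^ 2 := by
    refine Finset.sum_le_sum fun i _ => Finset.sum_le_sum fun j _ => ?_
    split_ifs
    · exact le_rfl
    · positivity
  have h2 : ∑ i, ∑ j, (z i - z j) ^ 2 = 2 * (N * ∑ i, z i ^ 2) - 2 * (∑ i, z i) ^ 2 := by
    simp only [sub_sq, Finset.sum_add_distrib, Finset.sum_sub_distrib, ← Finset.mul_sum,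
      ← Finset.sum_mul, Finset.sum_const, Finset.card_univ, Fintype.card_fin, nsmul_eq_mul]
    ring
  rw [inner_lapOp_self, norm_sq_eq_sum]
  nlinarith [sq_nonneg (∑ i, z i)]

open Classical in
lemma norm_lapOp_sq_le_of_degree {R : ℝ}
    (hR : ∀ i j, G.Adj i j → (G.degree i : ℝ) + G.degree j ≤ R)
    (z : EuclideanSpace ℝ (Fin N)) :
    ‖lapOp G z‖ ^ 2 ≤ R * inner ℝ z (lapOp G z) := by
  have hdeg : ∀ i, (∑ j, if G.Adj i j then (1 : ℝ) else 0) = G.degree i := by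
    intro i
    rw [SimpleGraph.degree_eq_sum_if_adj]
  have h1 : ‖lapOp G z‖ ^ 2 ≤
      ∑ i, ∑ j, if G.Adj i j then (G.degree i : ℝ) * (z i - z j) ^ 2 else 0 := by
    rw [norm_sq_eq_sum]
    refine Finset.sum_le_sum fun i _ => ?_
    have hcs := Finset.sum_mul_sq_le_sq_mul_sq Finset.univ
      (fun j => if G.Adj i j then (1 : ℝ) else 0)
      (fun j => if G.Adj i j then z i - z j else 0)
    have e1 : ∀ j, (if G.Adj i j then (1 : ℝ) else 0) * (if G.Adj i j then z i - z j else 0) =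
        if G.Adj i j then z i - z j else 0 := fun j => by split_ifs <;> simp
    have e2 : ∀ j, (if G.Adj i j then (1 : ℝ) else 0) ^ 2 = if G.Adj i j then 1 else 0 :=
      fun j => by split_ifs <;> simp
    simp only [e1, e2, hdeg] at hcs
    rw [lapOp_apply]
    refine hcs.trans (le_of_eq ?_)
    rw [Finset.mul_sum]
    exact Finset.sum_congr rfl fun j _ => by split_ifs <;> simp
  have h2 : ∑ i, ∑ j, (if G.Adj i j then (G.degree i : ℝ) * (z i - z j) ^ 2 else 0) =
      ∑ i, ∑ j, if G.Adj i j then (G.degree j : ℝ) * (z i - z j) ^ 2 else 0 := by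
    rw [Finset.sum_comm]
    refine Finset.sum_congr rfl fun i _ => Finset.sum_congr rfl fun j _ => ?_
    rw [G.adj_comm, ← neg_sub (z i), neg_sq]
  have h3 : ∑ i, ∑ j, (if G.Adj i j then (G.degree i : ℝ) * (z i - z j) ^ 2 else 0) +
      ∑ i, ∑ j, (if G.Adj i j then (G.degree j : ℝ) * (z i - z j) ^ 2 else 0) ≤
      R * ∑ i, ∑ j, if G.Adj i j then (z i - z j) ^ 2 else 0 := by
    rw [← Finset.sum_add_distrib, Finset.mul_sum]
    refine Finset.sum_le_sum fun i _ => ?_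
    rw [← Finset.sum_add_distrib, Finset.mul_sum]
    refine Finset.sum_le_sum fun j _ => ?_
    split_ifs with h
    · nlinarith [hR i j h, sq_nonneg (z i - z j)]
    · simp
  rw [inner_lapOp_self]
  linarith

open Classical in
/-- The largest eigenvalue of a graph Laplacian is at most the largest degree sum `d i + d j` over
the edges `ij` (Anderson and Morley). -/
lemma inner_lapOp_self_le_of_degree {R : ℝ}
    (hR : ∀ i j, G.Adj i j → (G.degree i : ℝ) + G.degree j ≤ R)
    (hR0 : 0 ≤ R) (z : EuclideanSpace ℝ (Fin N)) :
    inner ℝ z (lapOp G z) ≤ R * ‖z‖ ^ 2 := by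
  have hop := norm_lapOp_sq_le_of_degree G hR z
  have h0 := inner_lapOp_self_nonneg G z
  have hcs : inner ℝ z (lapOp G z) ≤ ‖z‖ * ‖lapOp G z‖ := real_inner_le_norm _ _
  rcases h0.eq_or_lt with h | h
  · rw [← h]; positivity
  · have : inner ℝ z (lapOp G z) ^ 2 ≤ ‖z‖ ^ 2 * (R * inner ℝ z (lapOp G z)) := by
      calc _ ≤ (‖z‖ * ‖lapOp G z‖) ^ 2 := by gcongr
        _ = ‖z‖ ^ 2 * ‖lapOp G z‖ ^ 2 := by ring
        _ ≤ _ := by gcongr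
    nlinarith

end Operator

/-! ### Rayleigh quotients and the sorted eigenvalues -/

section Spectrum

variable {N : ℕ} (G : SimpleGraph (Fin N))

lemma lapEigenvalue_monotone : Monotone (lapEigenvalue G) := by
  classical
  intro i j hij
  refine (G.isHermitian_lapMatrix ℝ).eigenvalues₀_antitone ?_
  simpa [Fin.le_def] using Fin.rev_le_rev.mpr hij

lemma exists_eigenbasis : ∃ b : OrthonormalBasis (Fin N) ℝ (EuclideanSpace ℝ (Fin N)),
    ∀ i, lapOp G (b i) = lapEigenvalue G i • b i := by
  classical
  let hA := G.isHermitian_lapMatrix ℝ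
  let e : Fin (Fintype.card (Fin N)) ≃ Fin N := Fintype.equivOfCardEq (Fintype.card_fin _)
  let r : Fin N ≃ Fin (Fintype.card (Fin N)) :=
    Fin.revPerm.trans (finCongr (Fintype.card_fin N).symm)
  refine ⟨hA.eigenvectorBasis.reindex (r.trans e).symm, fun i => ?_⟩
  have h := hA.mulVec_eigenvectorBasis ((r.trans e) i)
  have h2 : hA.eigenvalues ((r.trans e) i) = lapEigenvalue G i := by
    simp only [Matrix.IsHermitian.eigenvalues, lapEigenvalue]
    congr 1
    change e.symm (e (r i)) = _
    rw [Equiv.symm_apply_apply]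
    rfl
  rw [h2] at h
  rw [OrthonormalBasis.reindex_apply, Equiv.symm_symm]
  ext1
  exact congrFun h _

/-- `∑ i, λ i * ⟪b i, z⟫²` is the quadratic form of the Laplacian. -/
lemma inner_lapOp_eq_sum {b : OrthonormalBasis (Fin N) ℝ (EuclideanSpace ℝ (Fin N))}
    (hb : ∀ i, lapOp G (b i) = lapEigenvalue G i • b i) (z : EuclideanSpace ℝ (Fin N)) :
    inner ℝ z (lapOp G z) = ∑ i, lapEigenvalue G i * inner ℝ (b i) z ^ 2 := by
  rw [← b.sum_inner_mul_inner]
  refine Finset.sum_congr rfl fun i _ => ?_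
  rw [← lapOp_isSymmetric G (b i) z, hb, inner_smul_left, real_inner_comm]
  simp
  ring

lemma norm_sq_eq_sum_basis (b : OrthonormalBasis (Fin N) ℝ (EuclideanSpace ℝ (Fin N)))
    (z : EuclideanSpace ℝ (Fin N)) : ‖z‖ ^ 2 = ∑ i, inner ℝ (b i) z ^ 2 := by
  rw [← real_inner_self_eq_norm_sq, ← b.sum_inner_mul_inner]
  exact Finset.sum_congr rfl fun i _ => by rw [real_inner_comm]; ring

lemma inner_eq_zero_of_eigenvalue_ne {x y : EuclideanSpace ℝ (Fin N)} {a c : ℝ}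
    (hx : lapOp G x = a • x) (hy : lapOp G y = c • y) (hac : a ≠ c) : inner ℝ x y = 0 := by
  have h := lapOp_isSymmetric G x y
  rw [hx, hy, inner_smul_left, inner_smul_right] at h
  simp only [conj_trivial] at h
  have : (a - c) * inner ℝ x y = 0 := by linear_combination h
  exact (mul_eq_zero.mp this).resolve_left (sub_ne_zero.mpr hac)

lemma lapEigenvalue_nonneg (i : Fin N) : 0 ≤ lapEigenvalue G i := by
  obtain ⟨b, hb⟩ := exists_eigenbasis G
  have h := inner_lapOp_self_nonneg G (b i)
  rw [hb, inner_smul_right, real_inner_self_eq_norm_sq, b.norm_eq_one] at h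
  simpa using h

lemma lapEigenvalue_le (i : Fin N) : lapEigenvalue G i ≤ N := by
  obtain ⟨b, hb⟩ := exists_eigenbasis G
  have h := inner_lapOp_self_le G (b i)
  rw [hb, inner_smul_right, real_inner_self_eq_norm_sq, b.norm_eq_one] at h
  simpa using h

lemma lapEigenvalue_zero (hN : 0 < N) : lapEigenvalue G ⟨0, hN⟩ = 0 := by
  obtain ⟨b, hb⟩ := exists_eigenbasis G
  by_contra hne
  have hpos : ∀ i, lapEigenvalue G i ≠ 0 := fun i => by
    have h1 := lapEigenvalue_monotone G (show (⟨0, hN⟩ : Fin N) ≤ i from Nat.zero_le _)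
    have h2 := lapEigenvalue_nonneg G ⟨0, hN⟩
    exact (lt_of_lt_of_le (lt_of_le_of_ne h2 (Ne.symm hne)) h1).ne'
  have h0 : ‖ones N‖ ^ 2 = 0 := by
    rw [norm_sq_eq_sum_basis b]
    refine Finset.sum_eq_zero fun i _ => ?_
    rw [inner_eq_zero_of_eigenvalue_ne G (hb i) (c := 0) (by simp [lapOp_ones]) (hpos i)]
    simp
  rw [norm_sq_eq_sum] at h0
  simp [ones] at h0
  omega

lemma inner_lapOp_self_le_last (hN : 0 < N) (z : EuclideanSpace ℝ (Fin N)) :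
    inner ℝ z (lapOp G z) ≤ lapEigenvalue G ⟨N - 1, by omega⟩ * ‖z‖ ^ 2 := by
  obtain ⟨b, hb⟩ := exists_eigenbasis G
  rw [inner_lapOp_eq_sum G hb, norm_sq_eq_sum_basis b, Finset.mul_sum]
  refine Finset.sum_le_sum fun i _ => ?_
  gcongr
  exact lapEigenvalue_monotone G (Fin.le_def.mpr (by have := i.2; simp; omega))

/-- On the orthogonal complement of `ones`, the Laplacian is bounded below by `λ₂`. -/
lemma le_inner_lapOp_self (hN : 1 < N) {z : EuclideanSpace ℝ (Fin N)}
    (hz : inner ℝ (ones N) z = 0) :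
    lapEigenvalue G ⟨1, hN⟩ * ‖z‖ ^ 2 ≤ inner ℝ z (lapOp G z) := by
  rcases (lapEigenvalue_nonneg G ⟨1, hN⟩).eq_or_lt with h0 | hpos
  · rw [← h0, zero_mul]
    exact inner_lapOp_self_nonneg G z
  obtain ⟨b, hb⟩ := exists_eigenbasis G
  have hlt : ∀ i : Fin N, i ≠ ⟨0, by omega⟩ →
      lapEigenvalue G ⟨1, hN⟩ ≤ lapEigenvalue G i := fun i hi =>
    lapEigenvalue_monotone G (Fin.le_def.mpr (Nat.one_le_iff_ne_zero.mpr
      fun h => hi (Fin.ext h)))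
  have hone : ones N = inner ℝ (b ⟨0, by omega⟩) (ones N) • b ⟨0, by omega⟩ := by
    conv_lhs => rw [← b.sum_repr' (ones N)]
    refine Finset.sum_eq_single _ (fun i _ hi => ?_) (by simp)
    rw [inner_eq_zero_of_eigenvalue_ne G (hb i) (c := 0) (by simp [lapOp_ones])
      (hpos.trans_le (hlt i hi)).ne', zero_smul]
  have hb0 : inner ℝ (b ⟨0, by omega⟩) z = 0 := by
    rw [hone, inner_smul_left] at hz
    refine (mul_eq_zero.mp hz).resolve_left fun h => ?_
    simp only [conj_trivial] at h
    rw [h, zero_smul] at hone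
    have h0 : ‖ones N‖ ^ 2 = 0 := by rw [hone]; simp
    rw [norm_sq_eq_sum] at h0
    simp [ones] at h0
    omega
  rw [inner_lapOp_eq_sum G hb, norm_sq_eq_sum_basis b, Finset.mul_sum]
  refine Finset.sum_le_sum fun i _ => ?_
  by_cases hi : i = ⟨0, by omega⟩
  · rw [hi, hb0]; simp
  · gcongr
    exact hlt i hi

/-- If `λ₂ = 0`, some null vector of the Laplacian is orthogonal to `ones`. -/
lemma exists_kernel_vector (hN : 1 < N) (h0 : lapEigenvalue G ⟨1, hN⟩ = 0) :
    ∃ v : EuclideanSpace ℝ (Fin N), ‖v‖ = 1 ∧ inner ℝ (ones N) v = 0 ∧ lapOp G v = 0 := by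
  -- a combination of the first two vectors of an eigenbasis
  obtain ⟨b, hb⟩ := exists_eigenbasis G
  set e := b ⟨0, by omega⟩ with he
  set f := b ⟨1, hN⟩ with hf
  have hLe : lapOp G e = 0 := by rw [he, hb, lapEigenvalue_zero, zero_smul]
  have hLf : lapOp G f = 0 := by rw [hf, hb, h0, zero_smul]
  have hef : inner ℝ e f = 0 := b.orthonormal.2 (by simp [Fin.ext_iff])
  have hee : inner ℝ e e = 1 := by rw [real_inner_self_eq_norm_sq, b.norm_eq_one]; norm_num
  have hff : inner ℝ f f = 1 := by rw [real_inner_self_eq_norm_sq, b.norm_eq_one]; norm_num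
  by_cases hf1 : inner ℝ (ones N) f = 0
  · exact ⟨f, b.norm_eq_one _, hf1, hLf⟩
  · set z := inner ℝ (ones N) f • e - inner ℝ (ones N) e • f with hz
    have hz0 : z ≠ 0 := by
      intro h
      have : inner ℝ e z = 0 := by rw [h, inner_zero_right]
      rw [hz, inner_sub_right, inner_smul_right, inner_smul_right, hef, hee] at this
      simp at this
      exact hf1 this
    have hn : ‖z‖ ≠ 0 := norm_ne_zero_iff.mpr hz0
    refine ⟨‖z‖⁻¹ • z, by rw [norm_smul, norm_inv, norm_norm, inv_mul_cancel₀ hn], ?_, ?_⟩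
    · rw [inner_smul_right, hz, inner_sub_right, inner_smul_right, inner_smul_right]
      ring
    · rw [map_smul, hz, map_sub, map_smul, map_smul, hLe, hLf]
      simp

/-- If `0 < λ₂ < λ₃`, the Laplacian is bounded below by `λ₃` on the orthogonal complement of `ones`
and of an eigenvector for `λ₂`. -/
lemma third_le_inner_lapOp_self (hN : 2 < N) (h01 : 0 < lapEigenvalue G ⟨1, by omega⟩)
    (h12 : lapEigenvalue G ⟨1, by omega⟩ < lapEigenvalue G ⟨2, hN⟩)
    {u : EuclideanSpace ℝ (Fin N)} (hu1 : u ≠ 0)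
    (hu : lapOp G u = lapEigenvalue G ⟨1, by omega⟩ • u)
    {z : EuclideanSpace ℝ (Fin N)} (hz : inner ℝ (ones N) z = 0) (hz' : inner ℝ u z = 0) :
    lapEigenvalue G ⟨2, hN⟩ * ‖z‖ ^ 2 ≤ inner ℝ z (lapOp G z) := by
  obtain ⟨b, hb⟩ := exists_eigenbasis G
  set i0 : Fin N := ⟨0, by omega⟩ with hi0
  set i1 : Fin N := ⟨1, by omega⟩ with hi1
  have hlt : ∀ i : Fin N, i ≠ i0 → i ≠ i1 →
      lapEigenvalue G ⟨2, hN⟩ ≤ lapEigenvalue G i := fun i h0 h1 =>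
    lapEigenvalue_monotone G (Fin.le_def.mpr (by
      have h0' : i.1 ≠ 0 := fun h => h0 (Fin.ext h)
      have h1' : i.1 ≠ 1 := fun h => h1 (Fin.ext h)
      change 2 ≤ i.1
      omega))
  have key : ∀ (y : EuclideanSpace ℝ (Fin N)) (i : Fin N), y ≠ 0 →
      (∀ j, j ≠ i → inner ℝ (b j) y = 0) → inner ℝ y z = 0 → inner ℝ (b i) z = 0 := by
    intro y i hy hj hyz
    have hyi : y = inner ℝ (b i) y • b i := by
      conv_lhs => rw [← b.sum_repr' y]
      exact Finset.sum_eq_single _ (fun j _ h => by rw [hj j h, zero_smul]) (by simp)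
    rw [hyi, inner_smul_left] at hyz
    refine (mul_eq_zero.mp hyz).resolve_left fun h => hy ?_
    simp only [conj_trivial] at h
    rw [hyi, h, zero_smul]
  have hl0 : lapEigenvalue G i0 = 0 := lapEigenvalue_zero G _
  have hb0 : inner ℝ (b i0) z = 0 := by
    refine key (ones N) i0 ?_ (fun j hj => ?_) hz
    · intro h
      have h0 : ‖ones N‖ ^ 2 = 0 := by rw [h]; simp
      rw [norm_sq_eq_sum] at h0
      simp [ones] at h0
      omega
    · refine inner_eq_zero_of_eigenvalue_ne G (hb j) (c := 0) (by simp [lapOp_ones]) ?_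
      by_cases h1 : j = i1
      · rw [h1]; exact h01.ne'
      · exact (h01.trans (h12.trans_le (hlt j hj h1))).ne'
  have hb1 : inner ℝ (b i1) z = 0 := by
    refine key u i1 hu1 (fun j hj => inner_eq_zero_of_eigenvalue_ne G (hb j) hu ?_) hz'
    by_cases h0 : j = i0
    · rw [h0, hl0]; exact h01.ne
    · exact (h12.trans_le (hlt j h0 hj)).ne'
  rw [inner_lapOp_eq_sum G hb, norm_sq_eq_sum_basis b, Finset.mul_sum]
  refine Finset.sum_le_sum fun i _ => ?_
  by_cases h0 : i = i0
  · rw [h0, hb0]; simp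
  by_cases h1 : i = i1
  · rw [h1, hb1]; simp
  gcongr
  exact hlt i h0 h1

open Classical in
lemma sum_lapEigenvalue : ∑ i, lapEigenvalue G i = 2 * (G.edgeFinset.card : ℝ) := by
  let hA := G.isHermitian_lapMatrix ℝ
  have h1 : ∑ i, lapEigenvalue G i = (G.lapMatrix ℝ).trace := by
    rw [hA.trace_eq_sum_eigenvalues]
    refine Fintype.sum_equiv ((Fin.revPerm.trans (finCongr (Fintype.card_fin N).symm)).trans
      (Fintype.equivOfCardEq (Fintype.card_fin _))) _ _ fun i => ?_
    simp only [Matrix.IsHermitian.eigenvalues, lapEigenvalue, Equiv.trans_apply,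
      Equiv.symm_apply_apply]
    rfl
  rw [h1, SimpleGraph.lapMatrix, Matrix.trace_sub, SimpleGraph.trace_adjMatrix, sub_zero,
    SimpleGraph.degMatrix, Matrix.trace_diagonal]
  exact_mod_cast G.sum_degrees_eq_twice_card_edges

open Classical in
lemma lapEigenvalue_two_three_le (hN : 2 < N) :
    lapEigenvalue G ⟨1, by omega⟩ + (N - 2) * lapEigenvalue G ⟨2, hN⟩ ≤
      2 * (G.edgeFinset.card : ℝ) := by
  rw [← sum_lapEigenvalue]
  obtain ⟨M, rfl⟩ : ∃ M, N = M + 2 := ⟨N - 2, by omega⟩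
  rw [Fin.sum_univ_succ, Fin.sum_univ_succ]
  have h0 := lapEigenvalue_nonneg G 0
  have h : ∑ i : Fin M, lapEigenvalue G ⟨2, hN⟩ ≤
      ∑ i : Fin M, lapEigenvalue G i.succ.succ :=
    Finset.sum_le_sum fun i _ => lapEigenvalue_monotone G (Fin.le_def.mpr (by simp))
  simp only [Finset.sum_const, Finset.card_univ, Fintype.card_fin, nsmul_eq_mul] at h
  have e : (Fin.succ (0 : Fin (M + 1))) = ⟨1, by omega⟩ := rfl
  rw [e]
  push_cast
  linarith

open Classical in
/-- The largest Laplacian eigenvalue exceeds every positive degree by at least one, as the test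
vector with entry `d i` at `i` and `-1` at its neighbours shows. -/
lemma degree_add_one_le (hN : 0 < N) {i : Fin N} (hi : 0 < G.degree i) :
    (G.degree i : ℝ) + 1 ≤ lapEigenvalue G ⟨N - 1, by omega⟩ := by
  set d : ℝ := (G.degree i : ℝ) with hd
  have hdpos : 0 < d := Nat.cast_pos.mpr hi
  let z : EuclideanSpace ℝ (Fin N) :=
    WithLp.toLp 2 fun j => if j = i then d else if G.Adj i j then -1 else 0
  have hzi : z i = d := by simp [z]
  have hzj : ∀ j, G.Adj i j → z j = -1 := fun j hj => by simp [z, hj, hj.ne']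
  have hdeg : (∑ j, if G.Adj i j then (1 : ℝ) else 0) = d := by
    rw [hd, SimpleGraph.degree_eq_sum_if_adj]
  have hn : ‖z‖ ^ 2 = d ^ 2 + d := by
    rw [norm_sq_eq_sum]
    have : ∀ j, z j ^ 2 = (if j = i then d ^ 2 else 0) + if G.Adj i j then 1 else 0 := by
      intro j
      by_cases hj : j = i
      · subst hj; simp [hzi]
      · by_cases ha : G.Adj i j <;> simp [z, hj, ha]
    simp only [this, Finset.sum_add_distrib, hdeg]
    simp
  have hrow : ∀ k, (∑ j, if G.Adj k j then (z k - z j) ^ 2 else 0) ≥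
      if k = i then d * (d + 1) ^ 2 else if G.Adj i k then (d + 1) ^ 2 else 0 := by
    intro k
    have hnn : ∀ j ∈ Finset.univ, 0 ≤ if G.Adj k j then (z k - z j) ^ 2 else 0 :=
      fun j _ => by split_ifs <;> positivity
    by_cases hk : k = i
    · subst hk
      rw [if_pos rfl, ← hdeg, Finset.sum_mul]
      refine Finset.sum_le_sum fun j _ => ?_
      split_ifs with h
      · rw [hzi, hzj j h, hdeg, one_mul, sub_neg_eq_add]
      · simp
    · rw [if_neg hk]
      split_ifs with h
      · refine le_trans ?_ (Finset.single_le_sum hnn (Finset.mem_univ i))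
        rw [if_pos h.symm, hzi, hzj k h]
        nlinarith
      · exact Finset.sum_nonneg hnn
  have hq : d * (d + 1) ^ 2 ≤ inner ℝ z (lapOp G z) := by
    rw [inner_lapOp_self]
    have h := Finset.sum_le_sum (s := Finset.univ) fun k _ => hrow k
    have h2 : ∑ k, (if k = i then d * (d + 1) ^ 2 else if G.Adj i k then (d + 1) ^ 2 else 0) =
        2 * (d * (d + 1) ^ 2) := by
      have : ∀ k, (if k = i then d * (d + 1) ^ 2 else if G.Adj i k then (d + 1) ^ 2 else 0) =
          (if k = i then d * (d + 1) ^ 2 else 0) +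
            (if G.Adj i k then (1 : ℝ) else 0) * (d + 1) ^ 2 := by
        intro k
        by_cases hk : k = i
        · subst hk; simp
        · by_cases ha : G.Adj i k <;> simp [hk, ha]
      simp only [this, Finset.sum_add_distrib, ← Finset.sum_mul, hdeg]
      simp
      ring
    linarith
  have h := hq.trans (inner_lapOp_self_le_last G hN z)
  rw [hn] at h
  have : d * (d + 1) * (d + 1) ≤ d * (d + 1) * lapEigenvalue G ⟨N - 1, by omega⟩ := by
    linarith
  exact le_of_mul_le_mul_left this (by positivity)

end Spectrum

/-! ### Perturbation of the second eigenvector -/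

section Perturbation

variable {E : Type*} [NormedAddCommGroup E] [InnerProductSpace ℝ E]

lemma sin_angle_eq_norm_sub {u v : E} (hu : ‖u‖ = 1) (hv : ‖v‖ = 1) :
    Real.sin (InnerProductGeometry.angle u v) = ‖v - inner ℝ u v • u‖ := by
  have h := InnerProductGeometry.sin_angle_mul_norm_mul_norm u v
  rw [hu, hv, mul_one, mul_one] at h
  rw [h, ← Real.sqrt_sq (norm_nonneg (v - inner ℝ u v • u))]
  congr 1
  rw [@norm_sub_sq_real, norm_smul, inner_smul_right, real_inner_self_eq_norm_sq,
    real_inner_self_eq_norm_sq, hu, hv, Real.norm_eq_abs, mul_pow, sq_abs, real_inner_comm u v]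
  ring

/-- A Davis–Kahan bound: `u` is an eigenvector of `A` for `μ`, `v` one of `B` for some `ν ≤ μ`, and
`B` is bounded below by `σ` on the common orthogonal complement of `e` and `u`. -/
lemma mul_sin_angle_le {A B : E →ₗ[ℝ] E} {e u v : E} {μ ν σ τ : ℝ} (hu : ‖u‖ = 1) (hv : ‖v‖ = 1)
    (heu : inner ℝ e u = 0) (hev : inner ℝ e v = 0) (hAu : A u = μ • u) (hBv : B v = ν • v)
    (hστ : τ ≤ σ - ν)
    (hσ : ∀ z, inner ℝ e z = 0 → inner ℝ u z = 0 → σ * ‖z‖ ^ 2 ≤ inner ℝ z (B z)) :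
    τ * Real.sin (InnerProductGeometry.angle u v) ≤ ‖A u - B u‖ := by
  rw [sin_angle_eq_norm_sub hu hv]
  set α := inner ℝ u v with hα
  set w := v - α • u with hw
  have huw : inner ℝ u w = 0 := by
    rw [hw, inner_sub_right, inner_smul_right, real_inner_self_eq_norm_sq, hu]
    simp [hα]
  have hew : inner ℝ e w = 0 := by
    rw [hw, inner_sub_right, inner_smul_right, hev, heu]; simp
  have hv' : v = α • u + w := by rw [hw]; abel
  have h1 : inner ℝ w (B v) = ν * ‖w‖ ^ 2 := by
    rw [hBv, inner_smul_right]
    nth_rw 1 [hv']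
    rw [inner_add_right, inner_smul_right, real_inner_comm, huw, real_inner_self_eq_norm_sq]
    ring
  have h2 : inner ℝ w (B v) = α * inner ℝ w (B u) + inner ℝ w (B w) := by
    rw [hv', map_add, map_smul, inner_add_right, inner_smul_right]
  have h3 : inner ℝ w (A u) = 0 := by
    rw [hAu, inner_smul_right, real_inner_comm, huw, mul_zero]
  have h4 : inner ℝ w (B u) = - inner ℝ w (A u - B u) := by
    rw [inner_sub_right, h3]; ring
  have h5 : |inner ℝ w (A u - B u)| ≤ ‖w‖ * ‖A u - B u‖ := abs_real_inner_le_norm _ _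
  have hα1 : |α| ≤ 1 := by
    have := abs_real_inner_le_norm u v
    rwa [hu, hv, mul_one] at this
  have h6 : α * inner ℝ w (A u - B u) ≤ ‖w‖ * ‖A u - B u‖ := by
    refine (le_abs_self _).trans ?_
    rw [abs_mul]
    exact (mul_le_of_le_one_left (abs_nonneg _) hα1).trans h5
  have h7 := hσ w hew huw
  have h8 : ‖w‖ * (τ * ‖w‖) ≤ ‖w‖ * ‖A u - B u‖ := by
    have : τ * ‖w‖ ^ 2 ≤ (σ - ν) * ‖w‖ ^ 2 := by gcongr
    have h9 : α * inner ℝ w (B u) = -(α * inner ℝ w (A u - B u)) := by rw [h4]; ring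
    linarith
  rcases (norm_nonneg w).eq_or_lt with h | h
  · rw [← h]; simp
  · exact le_of_mul_le_mul_left h8 h

/-- If `B` has a null vector `v`, its distance from `A` at the eigenvector `u` of `A` is at least
comparable with the eigenvalue `μ`. Writing `v = α u + w` and `x = ⟪u, (A - B) u⟫ / μ`, and `y` for
the norm of the component of `(A - B) u / μ` orthogonal to `u`, one finds `x + y² / (1 + g) ≥ 1`,
which forces `x² + y² ≥ g²`. -/
lemma mul_le_norm_of_kernel {A B : E →ₗ[ℝ] E} (hB : B.IsSymmetric)
    {e u v : E} {μ σ g : ℝ} (hu : ‖u‖ = 1) (hv : ‖v‖ = 1)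
    (heu : inner ℝ e u = 0) (hev : inner ℝ e v = 0) (hAu : A u = μ • u) (hBv : B v = 0)
    (hμ : 0 < μ) (hg0 : 0 < g) (hg1 : g ≤ 1) (hgσ : (1 + g) * μ ≤ σ)
    (hσ : ∀ z, inner ℝ e z = 0 → inner ℝ u z = 0 → σ * ‖z‖ ^ 2 ≤ inner ℝ z (B z)) :
    g * μ ≤ ‖A u - B u‖ := by
  set α := inner ℝ u v with hα
  set w := v - α • u with hw
  set d := A u - B u with hd
  set X := inner ℝ u d with hX
  set r := d - X • u with hr
  have huu : inner ℝ u u = (1 : ℝ) := by rw [real_inner_self_eq_norm_sq, hu]; norm_num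
  have huw : inner ℝ u w = 0 := by
    rw [hw, inner_sub_right, inner_smul_right, huu]
    simp [hα]
  have hur : inner ℝ u r = 0 := by
    rw [hr, inner_sub_right, inner_smul_right, huu]
    simp [hX]
  have hew : inner ℝ e w = 0 := by
    rw [hw, inner_sub_right, inner_smul_right, hev, heu]; simp
  have hv' : v = α • u + w := by rw [hw]; abel
  have hBu : B u = (μ - X) • u - r := by
    rw [hr, sub_smul, ← hAu, hd]; abel
  have hdn : ‖d‖ ^ 2 = X ^ 2 + ‖r‖ ^ 2 := by
    have : d = X • u + r := by rw [hr]; abel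
    rw [this, @norm_add_sq_real, inner_smul_left, hur, norm_smul, hu, Real.norm_eq_abs, mul_one,
      sq_abs]
    simp
  have hwBu : inner ℝ w (B u) = - inner ℝ w r := by
    rw [hBu, inner_sub_right, inner_smul_right, real_inner_comm, huw]; ring
  have hBw : B w = -(α • B u) := by
    have : B v = α • B u + B w := by rw [hv', map_add, map_smul]
    rw [hBv] at this
    exact eq_neg_of_add_eq_zero_right this.symm
  have h7 : σ * ‖w‖ ^ 2 ≤ α * inner ℝ w r := by
    have := hσ w hew huw
    rwa [hBw, inner_neg_right, inner_smul_right, hwBu, mul_neg, neg_neg] at this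
  have h8 : α * (μ - X) = inner ℝ w r := by
    have : inner ℝ u (B w) = inner ℝ w (B u) := by rw [← hB, real_inner_comm]
    rw [hBw, hwBu, inner_neg_right, inner_smul_right, hBu, inner_sub_right, inner_smul_right,
      huu, hur] at this
    linarith
  have hcs : |inner ℝ w r| ≤ ‖w‖ * ‖r‖ := abs_real_inner_le_norm _ _
  have hσpos : 0 < σ := lt_of_lt_of_le (by positivity) hgσ
  have hα0 : 0 < |α| := by
    rw [abs_pos]
    intro h0
    rw [h0, zero_mul] at h7
    have hw0 : ‖w‖ ^ 2 ≤ 0 := by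
      by_contra h
      push Not at h
      nlinarith [mul_pos hσpos h]
    have : ‖w‖ = 0 := by nlinarith [norm_nonneg w]
    rw [hv', h0, zero_smul, zero_add, this] at hv
    norm_num at hv
  -- the tangent of the angle between `u` and `v` is at most `‖r‖ / σ`
  have h9 : σ * ‖w‖ ≤ |α| * ‖r‖ := by
    rcases (norm_nonneg w).eq_or_lt with h | h
    · rw [← h, mul_zero]; positivity
    · refine le_of_mul_le_mul_left ?_ h
      calc ‖w‖ * (σ * ‖w‖) = σ * ‖w‖ ^ 2 := by ring
        _ ≤ α * inner ℝ w r := h7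
        _ ≤ |α * inner ℝ w r| := le_abs_self _
        _ ≤ |α| * (‖w‖ * ‖r‖) := by rw [abs_mul]; gcongr
        _ = _ := by ring
  have h10 : σ * (μ - X) ≤ ‖r‖ ^ 2 := by
    have h1 : |α| * (μ - X) ≤ ‖w‖ * ‖r‖ := by
      calc |α| * (μ - X) ≤ |α| * |μ - X| := by gcongr; exact le_abs_self _
        _ = |inner ℝ w r| := by rw [← abs_mul, h8]
        _ ≤ _ := hcs
    refine le_of_mul_le_mul_left ?_ hα0
    calc |α| * (σ * (μ - X)) = σ * (|α| * (μ - X)) := by ring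
      _ ≤ σ * (‖w‖ * ‖r‖) := by gcongr
      _ = (σ * ‖w‖) * ‖r‖ := by ring
      _ ≤ (|α| * ‖r‖) * ‖r‖ := by gcongr
      _ = _ := by ring
  refine le_of_sq_le_sq ?_ (norm_nonneg d)
  rw [hdn]
  rcases le_or_gt μ X with h | h
  · nlinarith [sq_nonneg ‖r‖, mul_pos hμ hg0, mul_nonneg hμ.le (sub_nonneg.mpr hg1)]
  · have h11 : (1 + g) * μ * (μ - X) ≤ ‖r‖ ^ 2 :=
      (mul_le_mul_of_nonneg_right hgσ (by linarith)).trans h10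
    nlinarith [sq_nonneg (X - (1 + g) / 2 * μ), mul_nonneg (sq_nonneg μ)
      (mul_nonneg (show 0 ≤ 3 + 5 * g by linarith) (show 0 ≤ 1 - g by linarith))]

end Perturbation

section Graph

variable {N : ℕ} (G : SimpleGraph (Fin N))

lemma lapOp_deleteEdges {F : Set (Sym2 (Fin N))} (hF : F ⊆ G.edgeSet)
    (z : EuclideanSpace ℝ (Fin N)) :
    lapOp G z - lapOp (G.deleteEdges F) z = lapOp (SimpleGraph.fromEdgeSet F) z := by
  classical
  ext i
  rw [PiLp.sub_apply, lapOp_apply, lapOp_apply, lapOp_apply, ← Finset.sum_sub_distrib]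
  refine Finset.sum_congr rfl fun j _ => ?_
  have hG : s(i, j) ∈ F → G.Adj i j := fun h => G.mem_edgeSet.mp (hF h)
  have hne : G.Adj i j → i ≠ j := fun h => h.ne
  simp only [SimpleGraph.deleteEdges_adj, SimpleGraph.fromEdgeSet_adj]
  by_cases h1 : G.Adj i j <;> by_cases h2 : s(i, j) ∈ F <;> simp_all

lemma isSecondEigenvector_iff (hN : 3 ≤ N) (v : EuclideanSpace ℝ (Fin N)) :
    IsSecondEigenvector hN G v ↔
      ‖v‖ = 1 ∧ lapOp G v = lapEigenvalue G ⟨1, by omega⟩ • v := by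
  rfl

open Classical in
/-- If every removed edge `ij` has small degree sum in the graph of removed edges, the sine of the
angle between the second eigenvectors is controlled by the perturbation at `u`. -/
lemma mul_sin_angle_le_of_degree (hN : 3 ≤ N) {F : Set (Sym2 (Fin N))} (hF : F ⊆ G.edgeSet)
    {u v : EuclideanSpace ℝ (Fin N)} (hu : IsSecondEigenvector hN G u)
    (hv : IsSecondEigenvector hN (G.deleteEdges F) v) {R g : ℝ} (hR0 : 0 ≤ R)
    (hg0 : 0 < g) (hg1 : g ≤ 1)
    (hdeg : ∀ i j, s(i, j) ∈ F → ((SimpleGraph.fromEdgeSet F).degree i : ℝ) +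
      (SimpleGraph.fromEdgeSet F).degree j ≤ R)
    (h01 : 0 < lapEigenvalue G ⟨1, by omega⟩)
    (hgap : R + (1 + g) * lapEigenvalue G ⟨1, by omega⟩ ≤ lapEigenvalue G ⟨2, by omega⟩) :
    g * lapEigenvalue G ⟨1, by omega⟩ * Real.sin (InnerProductGeometry.angle u v) ≤
      ‖lapOp (SimpleGraph.fromEdgeSet F) u‖ := by
  rw [isSecondEigenvector_iff] at hu hv
  obtain ⟨hu1, hu⟩ := hu
  obtain ⟨hv1, hv⟩ := hv
  set H := G.deleteEdges F with hH
  set μ := lapEigenvalue G ⟨1, by omega⟩ with hμ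
  have heu : inner ℝ (ones N) u = 0 :=
    inner_eq_zero_of_eigenvalue_ne G (a := 0) (by simp [lapOp_ones]) hu h01.ne
  have hW : ∀ z, inner ℝ z (lapOp G z) - inner ℝ z (lapOp H z) =
      inner ℝ z (lapOp (SimpleGraph.fromEdgeSet F) z) := fun z => by
    rw [← lapOp_deleteEdges G hF, inner_sub_right]
  have hσ : ∀ z, inner ℝ (ones N) z = 0 → inner ℝ u z = 0 →
      (lapEigenvalue G ⟨2, by omega⟩ - R) * ‖z‖ ^ 2 ≤ inner ℝ z (lapOp H z) := by
    intro z hz1 hzu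
    have hu0 : u ≠ 0 := by
      intro h; rw [h] at hu1; simp at hu1
    have h1 := third_le_inner_lapOp_self G (by omega) h01 (by nlinarith) hu0 hu hz1 hzu
    have h2 := inner_lapOp_self_le_of_degree (SimpleGraph.fromEdgeSet F) (R := R)
      (fun i j hij => by convert hdeg i j ((SimpleGraph.fromEdgeSet_adj F).mp hij).1) hR0 z
    have h3 := hW z
    linarith
  have hquad : inner ℝ u (lapOp H u) ≤ μ := by
    have h1 := inner_lapOp_self_nonneg (SimpleGraph.fromEdgeSet F) u
    rw [← hW, hu, inner_smul_right, real_inner_self_eq_norm_sq, hu1] at h1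
    linarith
  rw [← lapOp_deleteEdges G hF]
  rcases (lapEigenvalue_nonneg H ⟨1, by omega⟩).eq_or_lt with h0 | hpos
  · obtain ⟨v₀, hv₀, hev₀, hLv₀⟩ := exists_kernel_vector H (by omega) h0.symm
    have h := mul_le_norm_of_kernel (A := lapOp G) (g := g) (lapOp_isSymmetric H) hu1 hv₀ heu hev₀
      hu hLv₀ h01 hg0 hg1 (by linarith) hσ
    refine le_trans ?_ h
    exact mul_le_of_le_one_right (by positivity) (Real.sin_le_one _)
  · have hev : inner ℝ (ones N) v = 0 :=
      inner_eq_zero_of_eigenvalue_ne H (a := 0) (by simp [lapOp_ones]) hv hpos.ne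
    refine mul_sin_angle_le hu1 hv1 heu hev hu hv ?_ hσ
    have h1 := le_inner_lapOp_self H (by omega) heu
    rw [hu1] at h1
    linarith

end Graph

/-! ### Independent deletion of edges -/

/-- The probability that a random subset of `s`, which contains each element independently with
probability `q`, equals `F`. -/
noncomputable def deletionWeight {α : Type*} (s : Finset α) (q : ℝ) (F : Finset α) : ℝ :=
  q ^ F.card * (1 - q) ^ (s.card - F.card)

section Weight

variable {α : Type*} {s : Finset α} {q : ℝ}

lemma deletionWeight_nonneg (hq0 : 0 ≤ q) (hq1 : q ≤ 1) (F : Finset α) :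
    0 ≤ deletionWeight s q F :=
  mul_nonneg (pow_nonneg hq0 _) (pow_nonneg (sub_nonneg.mpr hq1) _)

/-- The random subset contains a given `S ⊆ s` with probability `q ^ #S`. -/
lemma sum_deletionWeight_superset [DecidableEq α] {S : Finset α} (hS : S ⊆ s) :
    ∑ F ∈ s.powerset, deletionWeight s q F * (if S ⊆ F then 1 else 0) = q ^ S.card := by
  have h1 : ∑ F ∈ s.powerset, deletionWeight s q F * (if S ⊆ F then 1 else 0) =
      ∑ F ∈ Finset.Icc S s, deletionWeight s q F := by
    simp only [mul_ite, mul_one, mul_zero]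
    rw [← Finset.sum_filter]
    refine Finset.sum_congr ?_ fun _ _ => rfl
    ext F
    simp [and_comm]
  have hdisj : ∀ F ∈ (s \ S).powerset, Disjoint S F := fun F hF =>
    Finset.disjoint_of_subset_right (Finset.mem_powerset.mp hF) Finset.disjoint_sdiff
  rw [h1, Finset.Icc_eq_image_powerset hS, Finset.sum_image]
  · have h2 : ∀ F ∈ (s \ S).powerset, deletionWeight s q (S ∪ F) =
        q ^ S.card * (q ^ F.card * (1 - q) ^ ((s \ S).card - F.card)) := by
      intro F hF
      rw [deletionWeight, Finset.card_union_of_disjoint (hdisj F hF),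
        Finset.card_sdiff_of_subset hS, pow_add, Nat.sub_sub, mul_assoc]
    rw [Finset.sum_congr rfl h2, ← Finset.mul_sum, Finset.sum_pow_mul_eq_add_pow]
    simp
  · intro F hF F' hF' h
    have := congrArg (· \ S) h
    simpa [Finset.union_sdiff_cancel_left (hdisj F hF),
      Finset.union_sdiff_cancel_left (hdisj F' hF')] using this

end Weight

/-! ### Edges next to an edge -/

section AdjacentEdges

variable {V : Type*}

open Classical in
/-- The edges in `F` that differ from `e` and share an endpoint with it. -/
noncomputable def adjacentEdges (F : Finset (Sym2 V)) (e : Sym2 V) : Finset (Sym2 V) :=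
  F.filter fun f => f ≠ e ∧ ∃ x, x ∈ e ∧ x ∈ f

lemma adjacentEdges_subset (F : Finset (Sym2 V)) (e : Sym2 V) : adjacentEdges F e ⊆ F := by
  classical exact Finset.filter_subset _ _

lemma adjacentEdges_mono {F F' : Finset (Sym2 V)} (h : F ⊆ F') (e : Sym2 V) :
    adjacentEdges F e ⊆ adjacentEdges F' e := by
  classical exact Finset.filter_subset_filter _ h

lemma card_adjacentEdges [Fintype V] (G : SimpleGraph V) [DecidableRel G.Adj]
    {F : Finset (Sym2 V)} (hF : G.edgeSet = F) {i j : V} (h : G.Adj i j) :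
    (adjacentEdges F s(i, j)).card + 2 = G.degree i + G.degree j := by
  classical
  have h1 : adjacentEdges F s(i, j) =
      (G.incidenceFinset i ∪ G.incidenceFinset j).erase s(i, j) := by
    ext f
    simp only [adjacentEdges, Finset.mem_filter, ← Finset.mem_coe (s := F), ← hF, Finset.mem_erase,
      Finset.mem_union, SimpleGraph.mem_incidenceFinset, SimpleGraph.incidenceSet,
      Set.mem_ofPred_eq, Sym2.mem_iff]
    constructor
    · rintro ⟨h1, h2, x, rfl | rfl, h3⟩
      · exact ⟨h2, Or.inl ⟨h1, h3⟩⟩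
      · exact ⟨h2, Or.inr ⟨h1, h3⟩⟩
    · rintro ⟨h2, ⟨h1, h3⟩ | ⟨h1, h3⟩⟩
      · exact ⟨h1, h2, i, Or.inl rfl, h3⟩
      · exact ⟨h1, h2, j, Or.inr rfl, h3⟩
  have h2 : G.incidenceFinset i ∩ G.incidenceFinset j = {s(i, j)} := by
    rw [← Finset.coe_inj, Finset.coe_inter, SimpleGraph.coe_incidenceFinset,
      SimpleGraph.coe_incidenceFinset, G.incidenceSet_inter_incidenceSet_of_adj h]
    simp
  have h3 := Finset.card_union_add_card_inter (G.incidenceFinset i) (G.incidenceFinset j)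
  rw [h2, Finset.card_singleton, SimpleGraph.card_incidenceFinset_eq_degree,
    SimpleGraph.card_incidenceFinset_eq_degree] at h3
  have hmem : s(i, j) ∈ G.incidenceFinset i ∪ G.incidenceFinset j := by
    refine Finset.mem_union_left _ ?_
    rw [SimpleGraph.mem_incidenceFinset]
    exact ⟨h, Sym2.mem_mk_left i j⟩
  rw [h1, Finset.card_erase_of_mem hmem]
  have := Finset.card_pos.mpr ⟨_, hmem⟩
  omega

end AdjacentEdges

/-! ### The expected angle -/

section Expectation

variable {N : ℕ} (G : SimpleGraph (Fin N))

lemma lapOp_fromEdgeSet_eq_sum (F : Finset (Sym2 (Fin N))) (z : EuclideanSpace ℝ (Fin N)) :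
    lapOp (SimpleGraph.fromEdgeSet (F : Set (Sym2 (Fin N)))) z =
      ∑ e ∈ F, lapOp (SimpleGraph.fromEdgeSet {e}) z := by
  classical
  ext i
  rw [WithLp.ofLp_sum, Finset.sum_apply]
  simp only [lapOp_apply]
  rw [Finset.sum_comm]
  refine Finset.sum_congr rfl fun j _ => ?_
  simp only [SimpleGraph.fromEdgeSet_adj, Set.mem_singleton_iff, Finset.mem_coe]
  by_cases hij : i = j
  · simp [hij]
  · simp [hij]

/-- The Laplacian `Lₑ` of a single edge satisfies `Lₑ² = 2 Lₑ`; only `≤` is needed. -/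
lemma norm_lapOp_edge_sq_le (e : Sym2 (Fin N)) (z : EuclideanSpace ℝ (Fin N)) :
    ‖lapOp (SimpleGraph.fromEdgeSet {e}) z‖ ^ 2 ≤
      2 * inner ℝ z (lapOp (SimpleGraph.fromEdgeSet {e}) z) := by
  classical
  refine norm_lapOp_sq_le_of_degree _ (fun i j hij => ?_) z
  obtain ⟨he, hne⟩ := (SimpleGraph.fromEdgeSet_adj _).mp hij
  rw [Set.mem_singleton_iff] at he
  have h := card_adjacentEdges _ (F := {e}) (by
    ext f
    simp only [SimpleGraph.edgeSet_fromEdgeSet, Set.mem_sdiff, Set.mem_singleton_iff,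
      Finset.coe_singleton, and_iff_left_iff_imp]
    rintro rfl
    rw [← he]
    simpa using hne) hij
  have h0 : adjacentEdges {e} s(i, j) = ∅ := by
    ext f
    simp only [adjacentEdges, he, Finset.mem_filter, Finset.mem_singleton, Finset.notMem_empty,
      iff_false]
    exact fun hf => hf.2.1 hf.1
  rw [h0, Finset.card_empty, zero_add] at h
  have h' : ((SimpleGraph.fromEdgeSet {e}).degree i : ℝ) +
      (SimpleGraph.fromEdgeSet {e}).degree j = 2 := by exact_mod_cast h.symm
  refine le_of_eq ?_
  convert h'

open Classical in
lemma sum_norm_lapOp_edge_le (z : EuclideanSpace ℝ (Fin N)) :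
    ∑ e ∈ G.edgeFinset, ‖lapOp (SimpleGraph.fromEdgeSet {e}) z‖ ≤
      √(2 * G.edgeFinset.card * inner ℝ z (lapOp G z)) := by
  refine Real.le_sqrt_of_sq_le ?_
  have h1 := sq_sum_le_card_mul_sum_sq (s := G.edgeFinset)
    (f := fun e => ‖lapOp (SimpleGraph.fromEdgeSet {e}) z‖)
  have h2 : ∑ e ∈ G.edgeFinset, ‖lapOp (SimpleGraph.fromEdgeSet {e}) z‖ ^ 2 ≤
      2 * inner ℝ z (lapOp G z) := by
    refine (Finset.sum_le_sum fun e _ => norm_lapOp_edge_sq_le e z).trans (le_of_eq ?_)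
    rw [← Finset.mul_sum, ← inner_sum, ← lapOp_fromEdgeSet_eq_sum, SimpleGraph.coe_edgeFinset,
      SimpleGraph.fromEdgeSet_edgeSet]
  calc _ ≤ _ := h1
    _ ≤ (G.edgeFinset.card : ℝ) * (2 * inner ℝ z (lapOp G z)) := by gcongr
    _ = _ := by ring

open Classical in
/-- The expected sine is at most the expected size of the perturbation at `u G`, plus the
probability that `k` further edges next to a removed edge are removed as well. -/
lemma expectedSinAngle_le (hN : 3 ≤ N) {q : ℝ} (hq0 : 0 ≤ q) (hq1 : q ≤ 1)
    {u : SimpleGraph (Fin N) → EuclideanSpace ℝ (Fin N)}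
    (hu : ∀ H, IsSecondEigenvector hN H (u H)) {k : ℕ} {g : ℝ} (hg0 : 0 < g) (hg1 : g ≤ 1)
    (h01 : 0 < lapEigenvalue G ⟨1, by omega⟩)
    (hgap : (k + 1 : ℝ) + (1 + g) * lapEigenvalue G ⟨1, by omega⟩ ≤
      lapEigenvalue G ⟨2, by omega⟩) :
    expectedSinAngle G q u ≤
      q * (√(2 * G.edgeFinset.card * lapEigenvalue G ⟨1, by omega⟩) /
        (g * lapEigenvalue G ⟨1, by omega⟩)) +
      ∑ e ∈ G.edgeFinset, ((adjacentEdges G.edgeFinset e).card.choose k : ℝ) * q ^ (k + 1) := by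
  set μ := lapEigenvalue G ⟨1, by omega⟩ with hμ
  set E := G.edgeFinset with hE
  set c : Sym2 (Fin N) → ℝ := fun e =>
    ‖lapOp (SimpleGraph.fromEdgeSet {e}) (u G)‖ / (g * μ) with hc
  have hc0 : ∀ e, 0 ≤ c e := fun e => by positivity
  have hind0 : ∀ S F : Finset (Sym2 (Fin N)), (0 : ℝ) ≤ if S ⊆ F then 1 else 0 := fun S F => by
    split_ifs <;> norm_num
  -- pointwise bound by indicators of events of the form `S ⊆ F`
  have hpt : ∀ F ∈ E.powerset,
      Real.sin (InnerProductGeometry.angle (u G) (u (G.deleteEdges (F : Set (Sym2 (Fin N)))))) ≤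
      ∑ e ∈ E, c e * (if {e} ⊆ F then 1 else 0) +
        ∑ e ∈ E, ∑ S ∈ (adjacentEdges E e).powersetCard k, if insert e S ⊆ F then 1 else 0 := by
    intro F hFE
    rw [Finset.mem_powerset] at hFE
    have hF : (F : Set (Sym2 (Fin N))) ⊆ G.edgeSet := by
      rw [← SimpleGraph.coe_edgeFinset]; exact_mod_cast hFE
    have hnd : (SimpleGraph.fromEdgeSet (F : Set (Sym2 (Fin N)))).edgeSet = F := by
      ext e
      rw [SimpleGraph.edgeSet_fromEdgeSet]
      simp only [Set.mem_sdiff, Finset.mem_coe]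
      exact ⟨fun h => h.1, fun h => ⟨h, G.not_isDiag_of_mem_edgeSet (hF h)⟩⟩
    have hA0 : 0 ≤ ∑ e ∈ E, c e * (if {e} ⊆ F then (1 : ℝ) else 0) :=
      Finset.sum_nonneg fun e _ => mul_nonneg (hc0 e) (hind0 _ _)
    have hB0 : ∀ e ∈ E, 0 ≤
        ∑ S ∈ (adjacentEdges E e).powersetCard k, if insert e S ⊆ F then (1 : ℝ) else 0 :=
      fun e _ => Finset.sum_nonneg fun S _ => hind0 _ _
    by_cases hbad : ∃ e ∈ F, k ≤ (adjacentEdges F e).card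
    · obtain ⟨e, he, hk⟩ := hbad
      obtain ⟨S, hS, hSk⟩ := Finset.exists_subset_card_eq hk
      have hsub : adjacentEdges F e ⊆ adjacentEdges E e := adjacentEdges_mono hFE e
      have h1 : (1 : ℝ) ≤ ∑ e ∈ E, ∑ S ∈ (adjacentEdges E e).powersetCard k,
          if insert e S ⊆ F then (1 : ℝ) else 0 := by
        refine le_trans ?_ (Finset.single_le_sum hB0 (hFE he))
        refine le_trans ?_ (Finset.single_le_sum (fun S _ => hind0 _ _)
          (Finset.mem_powersetCard.mpr ⟨hS.trans hsub, hSk⟩))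
        rw [if_pos (Finset.insert_subset he (hS.trans (adjacentEdges_subset _ _)))]
      linarith [Real.sin_le_one (InnerProductGeometry.angle (u G)
        (u (G.deleteEdges (F : Set (Sym2 (Fin N))))))]
    · push Not at hbad
      have hdeg : ∀ i j, s(i, j) ∈ (F : Set (Sym2 (Fin N))) →
          ((SimpleGraph.fromEdgeSet (F : Set (Sym2 (Fin N)))).degree i : ℝ) +
            (SimpleGraph.fromEdgeSet (F : Set (Sym2 (Fin N)))).degree j ≤ k + 1 := by
        intro i j hij
        have hadj : (SimpleGraph.fromEdgeSet (F : Set (Sym2 (Fin N)))).Adj i j :=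
          (SimpleGraph.fromEdgeSet_adj _).mpr ⟨hij, (G.mem_edgeSet.mp (hF hij)).ne⟩
        have h1 := card_adjacentEdges _ hnd hadj
        have h2 := hbad _ (Finset.mem_coe.mp hij)
        have h3 : (SimpleGraph.fromEdgeSet (F : Set (Sym2 (Fin N)))).degree i +
            (SimpleGraph.fromEdgeSet (F : Set (Sym2 (Fin N)))).degree j ≤ k + 1 := by omega
        exact_mod_cast h3
      have h := mul_sin_angle_le_of_degree G hN hF (hu G) (hu _) (R := k + 1) (by positivity)
        hg0 hg1 (fun i j hij => by convert hdeg i j hij) h01 hgap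
      rw [lapOp_fromEdgeSet_eq_sum] at h
      have h2 : ∑ e ∈ E, c e * (if {e} ⊆ F then (1 : ℝ) else 0) = ∑ e ∈ F, c e := by
        simp only [Finset.singleton_subset_iff, mul_ite, mul_one, mul_zero]
        rw [← Finset.sum_filter, Finset.filter_mem_eq_inter, Finset.inter_eq_right.mpr hFE]
      have h3 : Real.sin (InnerProductGeometry.angle (u G)
          (u (G.deleteEdges (F : Set (Sym2 (Fin N)))))) ≤ ∑ e ∈ F, c e := by
        rw [hc, ← Finset.sum_div, le_div_iff₀ (by positivity), mul_comm]
        exact h.trans (norm_sum_le _ _)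
      rw [h2]
      linarith [Finset.sum_nonneg hB0]
  have hexp : expectedSinAngle G q u ≤ ∑ F ∈ E.powerset, deletionWeight E q F *
      (∑ e ∈ E, c e * (if {e} ⊆ F then 1 else 0) +
        ∑ e ∈ E, ∑ S ∈ (adjacentEdges E e).powersetCard k,
          if insert e S ⊆ F then 1 else 0) := by
    unfold expectedSinAngle noisyExpectation
    refine Finset.sum_le_sum fun F hF => ?_
    exact mul_le_mul_of_nonneg_left (hpt F hF) (deletionWeight_nonneg hq0 hq1 F)
  refine hexp.trans ?_
  simp only [mul_add, Finset.sum_add_distrib, Finset.mul_sum]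
  refine add_le_add ?_ ?_
  · rw [Finset.sum_comm]
    have h1 : ∀ e ∈ E, ∑ F ∈ E.powerset, deletionWeight E q F *
        (c e * (if {e} ⊆ F then (1 : ℝ) else 0)) = q * c e := by
      intro e he
      have := sum_deletionWeight_superset (q := q) (Finset.singleton_subset_iff.mpr he)
      rw [Finset.card_singleton, pow_one] at this
      nth_rw 2 [← this]
      rw [Finset.sum_mul]
      exact Finset.sum_congr rfl fun F _ => by ring
    rw [Finset.sum_congr rfl h1, ← Finset.mul_sum, hc, ← Finset.sum_div]
    gcongr
    refine (sum_norm_lapOp_edge_le G (u G)).trans (le_of_eq ?_)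
    obtain ⟨h1, h2⟩ := (isSecondEigenvector_iff G hN _).mp (hu G)
    rw [h2, inner_smul_right, real_inner_self_eq_norm_sq, h1]
    simp [hμ, hE]
  · rw [Finset.sum_comm]
    refine Finset.sum_le_sum fun e he => ?_
    rw [Finset.sum_comm]
    have h1 : ∀ S ∈ (adjacentEdges E e).powersetCard k, ∑ F ∈ E.powerset,
        deletionWeight E q F * (if insert e S ⊆ F then (1 : ℝ) else 0) = q ^ (k + 1) := by
      intro S hS
      rw [Finset.mem_powersetCard] at hS
      have he' : e ∉ S := fun h => by
        have := hS.1 h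
        simp [adjacentEdges] at this
      rw [sum_deletionWeight_superset
        (Finset.insert_subset he (hS.1.trans (adjacentEdges_subset _ _))),
        Finset.card_insert_of_notMem he', hS.2]
    rw [Finset.sum_congr rfl h1, Finset.sum_const, Finset.card_powersetCard, nsmul_eq_mul]

end Expectation

/-! ### The numerical inequality -/

/-- An upper bound for `q ^ k` times the number of ways to choose `k` edges next to a given edge, in
terms of `ℓ = λ₃ / ε`: there are at most `2 λ_N - 4` such edges, `λ_N ≤ N` and `q λ_N ≤ 2 ℓ / 25`.
The truncation at `0` only matters when there are fewer than `k` such edges. -/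
noncomputable def tailBound (N k : ℕ) (ℓ : ℝ) : ℝ :=
  (∏ j ∈ Finset.range k, 4 / 25 * ℓ * max (0 : ℝ) (1 - (4 + j) / (2 * N))) / k.factorial

lemma tailBound_nonneg {N k : ℕ} {ℓ : ℝ} (hℓ : 0 ≤ ℓ) : 0 ≤ tailBound N k ℓ :=
  div_nonneg (Finset.prod_nonneg fun j _ => by positivity) (by positivity)

lemma tailBound_le_pow {N k : ℕ} {ℓ : ℝ} (hℓ : 0 ≤ ℓ) :
    tailBound N k ℓ ≤ (4 / 25 * ℓ) ^ k / k.factorial := by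
  unfold tailBound
  have h : ∏ j ∈ Finset.range k, 4 / 25 * ℓ * max (0 : ℝ) (1 - (4 + j) / (2 * N)) ≤
      ∏ j ∈ Finset.range k, 4 / 25 * ℓ := by
    refine Finset.prod_le_prod (fun j _ => by positivity) fun j _ => ?_
    refine mul_le_of_le_one_right (by positivity) (max_le (by norm_num) ?_)
    have : (0 : ℝ) ≤ (4 + j) / (2 * N) := by positivity
    linarith
  rw [Finset.prod_const, Finset.card_range] at h
  gcongr

lemma tailBound_le_of_le {N N₂ k : ℕ} {ℓ ℓ₂ : ℝ} (hN0 : 0 < N) (hN : N ≤ N₂) (hℓ : 0 ≤ ℓ)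
    (hℓ₂ : ℓ ≤ ℓ₂) (hk : k + 3 ≤ 2 * N₂) :
    tailBound N k ℓ ≤
      (∏ j ∈ Finset.range k, 4 / 25 * ℓ₂ * (1 - (4 + j) / (2 * N₂))) / k.factorial := by
  unfold tailBound
  refine div_le_div_of_nonneg_right (Finset.prod_le_prod (fun j _ => by positivity)
    fun j hj => ?_) (by positivity)
  refine mul_le_mul (by linarith) ?_ (by positivity) (by linarith)
  rw [Finset.mem_range] at hj
  have hN0' : (0 : ℝ) < N := by exact_mod_cast hN0
  have hNN : (N : ℝ) ≤ N₂ := by exact_mod_cast hN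
  refine max_le ?_ ?_
  · rw [sub_nonneg, div_le_one (by linarith)]
    have : j + 4 ≤ 2 * N₂ := by omega
    have h : ((j + 4 : ℕ) : ℝ) ≤ ((2 * N₂ : ℕ) : ℝ) := by exact_mod_cast this
    push_cast at h
    linarith
  · gcongr

/-- `k` is an admissible threshold for the parameters `N`, `ℓ = λ₃ / ε` and `w = (λ₃ - ℓ) / 2`: if
every removed edge touches fewer than `k` other removed edges, a spectral gap of `g * λ₂` remains,
and the relative contributions `t` of this event and of its complement add up to at most `1`. -/
def HasThreshold (N : ℕ) (ℓ w : ℝ) : Prop :=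
  ∃ (k : ℕ) (g t : ℝ), 0 < g ∧ g ≤ 1 ∧ 0 ≤ t ∧ (k + 1 : ℝ) ≤ ℓ + (1 - g) * w ∧
    N * w ≤ t ^ 2 * g ^ 2 * (w + (N - 2) * (ℓ + 2 * w)) ∧
    t + w * √N / 2 * tailBound N k ℓ ≤ 1

lemma exp_le_of_pow_le {p r n : ℕ} (hr : r ≠ 0) (h : (2.7182818286 : ℝ) ^ p ≤ n ^ r) :
    Real.exp (p / r) ≤ n := by
  have hr' : (0 : ℝ) < r := by positivity
  refine le_of_pow_le_pow_left₀ hr (by positivity) ?_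
  rw [← Real.exp_nat_mul, mul_div_cancel₀ _ hr'.ne', ← Real.exp_one_pow]
  exact (pow_le_pow_left₀ (Real.exp_pos 1).le Real.exp_one_lt_d9.le p).trans h

lemma div_le_log {p r n N : ℕ} (hr : r ≠ 0) (h : (2.7182818286 : ℝ) ^ p ≤ n ^ r) (hn : 0 < n)
    (hN : n ≤ N) : (p : ℝ) / r ≤ Real.log N := by
  have h0 : (0 : ℝ) < n := by exact_mod_cast hn
  have hnN : (n : ℝ) ≤ N := by exact_mod_cast hN
  rw [Real.le_log_iff_exp_le (by linarith)]
  exact (exp_le_of_pow_le hr h).trans hnN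

/-- A threshold that works at the worst corners of a box of parameters works in the whole box. -/
lemma hasThreshold_of_box (N₁ N₂ k : ℕ) (l₁ l₂ w₁ w₂ g t s : ℝ) {N : ℕ} {ℓ w : ℝ}
    (hN₁ : N₁ ≤ N) (hN₂ : N ≤ N₂) (hl₁ : l₁ ≤ ℓ) (hl₂ : ℓ ≤ l₂) (hw₁ : w₁ ≤ w) (hw₂ : w ≤ w₂)
    (hpos : 2 < N₁ ∧ 0 < l₁ ∧ 0 < w₁ ∧ 0 ≤ s ∧ 0 < g ∧ g ≤ 1 ∧ 0 ≤ t ∧ t ≤ 1 ∧ k + 3 ≤ 2 * N₂)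
    (hk : (k + 1 : ℝ) ≤ l₁ + (1 - g) * w₁)
    (hmain : N₁ * w₂ ≤ t ^ 2 * g ^ 2 * (w₂ + (N₁ - 2) * (l₁ + 2 * w₂)))
    (hs : (N₂ : ℝ) ≤ s ^ 2)
    (htail : t + w₂ * s / 2 * ((∏ j ∈ Finset.range k, 4 / 25 * l₂ * (1 - (4 + j) / (2 * N₂))) /
      k.factorial) ≤ 1) : HasThreshold N ℓ w := by
  obtain ⟨h2, hl0, hw0, hs0, hg0, hg1, ht0, ht1, hkN⟩ := hpos
  refine ⟨k, g, t, hg0, hg1, ht0, ?_, ?_, ?_⟩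
  · nlinarith
  · have hc0 : 0 ≤ t ^ 2 * g ^ 2 := by positivity
    have hc1 : t ^ 2 * g ^ 2 ≤ 1 := by
      rw [← mul_pow]
      exact pow_le_one₀ (by positivity) (mul_le_one₀ ht1 hg0.le hg1)
    set c := t ^ 2 * g ^ 2 with hc
    have hN1 : (N₁ : ℝ) ≤ N := by exact_mod_cast hN₁
    have h2' : (2 : ℝ) < N₁ := by exact_mod_cast h2
    -- the inequality is linear in `w`, `ℓ` and `N`
    have hA : N₁ * w ≤ c * (w + (N₁ - 2) * (l₁ + 2 * w)) := by
      rcases le_total (N₁ - c - 2 * c * (N₁ - 2)) 0 with h | h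
      · have h3 : w * (N₁ - c - 2 * c * (N₁ - 2)) ≤ 0 := mul_nonpos_of_nonneg_of_nonpos
          (by linarith) h
        have h4 : 0 ≤ c * ((N₁ - 2) * l₁) := mul_nonneg hc0 (mul_nonneg (by linarith) hl0.le)
        nlinarith
      · nlinarith [mul_le_mul_of_nonneg_right hw₂ h]
    have hB : N₁ * w ≤ c * (w + (N₁ - 2) * (ℓ + 2 * w)) := by
      have : c * ((N₁ - 2) * l₁) ≤ c * ((N₁ - 2) * ℓ) :=
        mul_le_mul_of_nonneg_left (mul_le_mul_of_nonneg_left hl₁ (by linarith)) hc0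
      nlinarith
    have hD : w ≤ c * (ℓ + 2 * w) := by
      have h5 : (N₁ - 2) * w ≤ (N₁ - 2) * (c * (ℓ + 2 * w)) := by nlinarith
      exact le_of_mul_le_mul_left h5 (by linarith)
    nlinarith
  · refine le_trans ?_ htail
    have hl : 0 ≤ ℓ := by linarith
    have h1 := tailBound_le_of_le (k := k) (by omega) hN₂ hl hl₂ hkN
    have h0 := tailBound_nonneg (N := N) (k := k) hl
    have hsN : √N ≤ s := by
      rw [Real.sqrt_le_left hs0]
      exact le_trans (by exact_mod_cast hN₂) hs
    have hw0' : 0 ≤ w := by linarith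
    have hw₂' : 0 ≤ w₂ := by linarith
    have hws : 0 ≤ w₂ * s / 2 := by positivity
    gcongr

/-- `w * exp (-a w)` is largest at `w = 1 / a`. -/
lemma mul_exp_le {w : ℝ} {a : ℝ} (ha : 0 < a) : w * Real.exp (-(a * w)) ≤ (a * 2.718)⁻¹ := by
  have h1 := Real.add_one_le_exp (a * w - 1)
  have h2 : Real.exp (a * w - 1) = Real.exp (a * w) / Real.exp 1 := Real.exp_sub _ _
  have he : (2.718 : ℝ) < Real.exp 1 := lt_trans (by norm_num) Real.exp_one_gt_d9
  have h3 : a * w * Real.exp 1 ≤ Real.exp (a * w) := by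
    rw [h2] at h1
    rw [← le_div_iff₀ (Real.exp_pos 1)]
    linarith
  rw [Real.exp_neg, ← div_eq_mul_inv, div_le_iff₀ (Real.exp_pos _), inv_mul_eq_div,
    le_div_iff₀ (by positivity)]
  rcases le_or_gt w 0 with hw | hw
  · nlinarith [Real.exp_pos (a * w), mul_nonneg ha.le (neg_nonneg.mpr hw)]
  · nlinarith [mul_pos ha hw]

/-- Stirling's formula together with `exp x ≥ 1 + x`; the constant `6` is close to the value of
`k / x` at which this bound is needed. -/
lemma pow_div_factorial_le {x : ℝ} (hx : 0 ≤ x) {k : ℕ} (hk : 5 ≤ k) :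
    x ^ k / k.factorial ≤ Real.exp (6 * x) / (5.6 * 6 ^ k) := by
  have hk0 : (0 : ℝ) < k := by exact_mod_cast (by omega : 0 < k)
  have hk5 : (5 : ℝ) ≤ k := by exact_mod_cast hk
  have h1 := Stirling.le_factorial_stirling k
  have h2 : (5.6 : ℝ) ≤ √(2 * Real.pi * k) := by
    refine Real.le_sqrt_of_sq_le ?_
    nlinarith [Real.pi_gt_d2]
  have h3 : (x * 6) ^ k ≤ (k / Real.exp 1) ^ k * Real.exp (6 * x) := by
    have h4 : x * 6 ≤ k / Real.exp 1 * Real.exp (6 * x / k) := by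
      have h5 := Real.add_one_le_exp (6 * x / k - 1)
      rw [Real.exp_sub, sub_add_cancel] at h5
      calc x * 6 = k * (6 * x / k) := by field_simp
        _ ≤ k * (Real.exp (6 * x / k) / Real.exp 1) := by gcongr
        _ = _ := by ring
    calc (x * 6) ^ k ≤ (k / Real.exp 1 * Real.exp (6 * x / k)) ^ k := by gcongr
      _ = _ := by rw [mul_pow, ← Real.exp_nat_mul, mul_div_cancel₀ _ hk0.ne']
  rw [div_le_div_iff₀ (by positivity) (by positivity)]
  calc x ^ k * (5.6 * 6 ^ k) = 5.6 * (x * 6) ^ k := by rw [mul_pow]; ring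
    _ ≤ √(2 * Real.pi * k) * ((k / Real.exp 1) ^ k * Real.exp (6 * x)) := by gcongr
    _ = Real.exp (6 * x) * (√(2 * Real.pi * k) * (k / Real.exp 1) ^ k) := by ring
    _ ≤ _ := by gcongr

lemma sqrt_le_exp {N : ℕ} {ℓ : ℝ} (hN : 0 < N) (hℓ : 3 / 2 * Real.log N ≤ ℓ) :
    √N ≤ Real.exp (ℓ / 3) := by
  have h0 : (0 : ℝ) < N := by exact_mod_cast hN
  rw [Real.sqrt_eq_rpow, Real.rpow_def_of_pos h0]
  gcongr
  linarith

/-- The tail is small once the threshold is large. -/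
lemma tail_le_of_large {N k : ℕ} {ℓ w : ℝ} (hN : 0 < N) (hℓ : 3 / 2 * Real.log N ≤ ℓ) (hℓ0 : 0 ≤ ℓ)
    (hw : 0 ≤ w) (hk : 5 ≤ k) (hk' : ℓ + 3 / 20 * w < k + 1.7) :
    w * √N / 2 * tailBound N k ℓ ≤ 0.13 := by
  have h1 := (tailBound_le_pow (N := N) (k := k) hℓ0).trans
    (pow_div_factorial_le (x := 4 / 25 * ℓ) (by positivity) hk)
  have h2 := sqrt_le_exp hN hℓ
  have h0 := tailBound_nonneg (N := N) (k := k) hℓ0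
  -- `97 / 75 = 1 / 3 + 6 * (4 / 25)` collects the exponents of `√N` and of the tail
  have h3 : Real.exp (97 / 75) ≤ 3.6452 := by
    refine le_of_pow_le_pow_left₀ (n := 75) (by norm_num) (by norm_num) ?_
    rw [← Real.exp_nat_mul]
    have : ((75 : ℕ) : ℝ) * (97 / 75) = ((97 : ℕ) : ℝ) := by norm_num
    rw [this, ← Real.exp_one_pow]
    refine (pow_le_pow_left₀ (Real.exp_pos 1).le Real.exp_one_lt_d9.le 97).trans ?_
    norm_num
  have h4 : Real.exp (97 / 75 * 1.7) ≤ 9.026 := by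
    refine le_of_pow_le_pow_left₀ (n := 15) (by norm_num) (by norm_num) ?_
    rw [← Real.exp_nat_mul]
    have : ((15 : ℕ) : ℝ) * (97 / 75 * 1.7) ≤ ((33 : ℕ) : ℝ) := by norm_num
    refine (Real.exp_le_exp.mpr this).trans ?_
    rw [← Real.exp_one_pow]
    refine (pow_le_pow_left₀ (Real.exp_pos 1).le Real.exp_one_lt_d9.le 33).trans ?_
    norm_num
  have h5 : Real.exp (97 / 75 * ℓ) ≤
      Real.exp (97 / 75) ^ k * Real.exp (97 / 75 * 1.7) * Real.exp (-(97 / 500 * w)) := by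
    rw [← Real.exp_nat_mul, ← Real.exp_add, ← Real.exp_add]
    refine Real.exp_le_exp.mpr ?_
    nlinarith
  have h6 : w * Real.exp (-(97 / 500 * w)) ≤ (97 / 500 * 2.718)⁻¹ := mul_exp_le (by norm_num)
  have h7 : (3.6452 / 6 : ℝ) ^ k ≤ (3.6452 / 6 : ℝ) ^ 5 :=
    pow_le_pow_of_le_one (by norm_num) (by norm_num) hk
  calc w * √N / 2 * tailBound N k ℓ
      ≤ w * Real.exp (ℓ / 3) / 2 * (Real.exp (6 * (4 / 25 * ℓ)) / (5.6 * 6 ^ k)) := by gcongr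
    _ = w * Real.exp (97 / 75 * ℓ) / (11.2 * 6 ^ k) := by
        have : Real.exp (97 / 75 * ℓ) = Real.exp (ℓ / 3) * Real.exp (6 * (4 / 25 * ℓ)) := by
          rw [← Real.exp_add]; ring_nf
        rw [this]; field_simp; ring
    _ ≤ w * (Real.exp (97 / 75) ^ k * Real.exp (97 / 75 * 1.7) * Real.exp (-(97 / 500 * w))) /
          (11.2 * 6 ^ k) := by gcongr
    _ = (w * Real.exp (-(97 / 500 * w))) * Real.exp (97 / 75 * 1.7) / 11.2 *
          (Real.exp (97 / 75) / 6) ^ k := by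
        rw [div_pow]; field_simp
    _ ≤ (97 / 500 * 2.718)⁻¹ * 9.026 / 11.2 * (3.6452 / 6) ^ k := by gcongr
    _ ≤ (97 / 500 * 2.718)⁻¹ * 9.026 / 11.2 * (3.6452 / 6) ^ 5 := by gcongr
    _ ≤ 0.13 := by norm_num

/-- The linear term contributes at most `0.87` for large parameters, when a gap of
`(17 / 20 - 3 / (10 w)) λ₂` remains. -/
lemma main_term_le_of_large {N : ℕ} {ℓ w : ℝ} (hℓ : 3 / 2 * Real.log N ≤ ℓ) (hw : ℓ ≤ 2 * w)
    (hx : ℓ + 2 * w ≤ N) (hlarge : 5.7 ≤ ℓ + 3 / 20 * w) :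
    N * w ≤ 0.87 ^ 2 * (17 / 20 - 3 / 10 / w) ^ 2 * (w + (N - 2) * (ℓ + 2 * w)) := by
  have hw0 : 2.65 ≤ w := by linarith
  have hN : 10 ≤ N := by
    have : (9 : ℝ) < N := by linarith
    exact_mod_cast this
  have hlog : 3.4 ≤ ℓ := by
    have := div_le_log (p := 23) (r := 10) (n := 10) (by norm_num) (by norm_num) (by norm_num) hN
    norm_num at this
    linarith
  -- it suffices to treat `N = ℓ + 2 w`, and to bound the increasing factor below by a constant
  have key : ∀ c : ℝ, 0 ≤ c → c ≤ 0.87 ^ 2 * (17 / 20 - 3 / 10 / w) ^ 2 → w ≤ c * (ℓ + 2 * w) →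
      (ℓ + 2 * w) * w ≤ c * (w + (ℓ + 2 * w - 2) * (ℓ + 2 * w)) →
      N * w ≤ 0.87 ^ 2 * (17 / 20 - 3 / 10 / w) ^ 2 * (w + (N - 2) * (ℓ + 2 * w)) := by
    intro c hc0 hc h1 h2
    have h3 : N * w ≤ c * (w + (N - 2) * (ℓ + 2 * w)) := by
      nlinarith [mul_le_mul_of_nonneg_right hx (sub_nonneg.mpr h1)]
    have h4 : 0 ≤ w + (N - 2) * (ℓ + 2 * w) := by
      have : 0 ≤ ((N : ℝ) - 2) * (ℓ + 2 * w) := mul_nonneg (by linarith) (by linarith)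
      linarith
    exact h3.trans (mul_le_mul_of_nonneg_right hc h4)
  have hc : ∀ w₀ : ℝ, 1 ≤ w₀ → w₀ ≤ w → 0.87 ^ 2 * (17 / 20 - 3 / 10 / w₀) ^ 2 ≤
      0.87 ^ 2 * (17 / 20 - 3 / 10 / w) ^ 2 := by
    intro w₀ h1 h2
    have : 3 / 10 / w₀ ≤ 3 / 10 := by
      rw [div_le_iff₀ (by linarith)]; linarith
    have h5 : 0 ≤ 17 / 20 - 3 / 10 / w₀ := by linarith
    gcongr
  rcases le_total w 5 with h5 | h5
  · have hx : 5.7 + 1.85 * w ≤ ℓ + 2 * w := by linarith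
    refine key 0.41 (by norm_num) (le_trans (by norm_num) (hc 2.65 (by norm_num) hw0)) ?_ ?_
    · linarith
    · nlinarith [mul_nonneg (sub_nonneg.mpr hx) (sub_nonneg.mpr hx),
        mul_nonneg (sub_nonneg.mpr hx) (sub_nonneg.mpr hw0),
        mul_nonneg (sub_nonneg.mpr h5) (sub_nonneg.mpr hw0),
        mul_nonneg (sub_nonneg.mpr hx) (sub_nonneg.mpr h5)]
  · have hx : 2 * w + 3.4 ≤ ℓ + 2 * w := by linarith
    rcases le_total w 15 with h15 | h15
    · refine key 0.4723 (by norm_num) (le_trans (by norm_num) (hc 5 (by norm_num) h5)) ?_ ?_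
      · linarith
      · nlinarith [mul_nonneg (sub_nonneg.mpr hx) (sub_nonneg.mpr hx),
          mul_nonneg (sub_nonneg.mpr hx) (sub_nonneg.mpr h5),
          mul_nonneg (sub_nonneg.mpr h15) (sub_nonneg.mpr h5)]
    · refine key 0.52 (by norm_num) (le_trans (by norm_num) (hc 15 (by norm_num) h15)) ?_ ?_
      · linarith
      · nlinarith [mul_nonneg (sub_nonneg.mpr hx) (sub_nonneg.mpr hx),
          mul_nonneg (sub_nonneg.mpr hx) (sub_nonneg.mpr h15)]

/-- For large parameters the threshold `k + 1 = ⌊ℓ + 3 w / 20 + 3 / 10⌋` works. -/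
lemma hasThreshold_of_large {N : ℕ} {ℓ w : ℝ} (hℓ : 3 / 2 * Real.log N ≤ ℓ) (hw : ℓ ≤ 2 * w)
    (hx : ℓ + 2 * w ≤ N) (hlarge : 5.7 ≤ ℓ + 3 / 20 * w) (hℓ0 : 0 ≤ ℓ) : HasThreshold N ℓ w := by
  have hw0 : 2.65 ≤ w := by linarith
  have hN0 : 0 < N := by
    have : (0 : ℝ) < N := by linarith
    exact_mod_cast this
  have hf1 : ((6 : ℕ) : ℝ) ≤ ℓ + 3 / 20 * w + 3 / 10 := by push_cast; linarith
  have hfl : 6 ≤ ⌊ℓ + 3 / 20 * w + 3 / 10⌋₊ := Nat.le_floor hf1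
  obtain ⟨k, hk⟩ : ∃ k, ⌊ℓ + 3 / 20 * w + 3 / 10⌋₊ = k + 1 := ⟨_, (Nat.succ_pred_eq_of_pos
    (by omega)).symm⟩
  have h1 : ((k + 1 : ℕ) : ℝ) ≤ ℓ + 3 / 20 * w + 3 / 10 := by
    rw [← hk]; exact Nat.floor_le (by linarith)
  have h2 : ℓ + 3 / 20 * w + 3 / 10 < (k + 1 : ℕ) + 1 := by
    rw [← hk]; exact Nat.lt_floor_add_one _
  push_cast at h1 h2
  have hg : 3 / 10 / w ≤ 3 / 10 := by
    rw [div_le_iff₀ (by linarith)]; linarith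
  have hg0 : 0 ≤ 3 / 10 / w := by positivity
  refine ⟨k, 17 / 20 - 3 / 10 / w, 0.87, by linarith, by linarith, by norm_num, ?_,
    main_term_le_of_large hℓ hw hx hlarge, ?_⟩
  · have : (1 - (17 / 20 - 3 / 10 / w)) * w = 3 / 20 * w + 3 / 10 := by
      field_simp; ring
    linarith
  · have := tail_le_of_large (k := k) (w := w) hN0 hℓ hℓ0 (by linarith) (by omega) (by linarith)
    linarith

/-- The remaining parameters are covered by finitely many boxes. -/
lemma hasThreshold_of_small {N : ℕ} {ℓ w : ℝ} (hN3 : 3 ≤ N) (hℓ : 3 / 2 * Real.log N ≤ ℓ)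
    (hw : ℓ ≤ 2 * w) (hx : ℓ + 2 * w ≤ N) (hsmall : ℓ + 3 / 20 * w < 5.7) : HasThreshold N ℓ w := by
  have hlog : ∀ p r n : ℕ, r ≠ 0 → 0 < n → (2.7182818286 : ℝ) ^ p ≤ n ^ r → n ≤ N →
      3 / 2 * ((p : ℝ) / r) ≤ ℓ := fun p r n hr hn h hnN =>
    le_trans (mul_le_mul_of_nonneg_left (div_le_log hr h hn hnN) (by norm_num)) hℓ
  have hN5 : 5 ≤ N := by
    by_contra hN
    rcases (by omega : N = 3 ∨ N = 4) with rfl | rfl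
    · have h := hlog 23 21 3 (by norm_num) (by norm_num) (by norm_num) le_rfl
      norm_num at h hx
      linarith
    · have h := hlog 18 13 4 (by norm_num) (by norm_num) (by norm_num) le_rfl
      norm_num at h hx
      linarith
  have hN34 : N ≤ 34 := by
    by_contra hN
    have h := hlog 71 20 35 (by norm_num) (by norm_num) (by norm_num) (by omega)
    norm_num at h
    linarith
  rcases le_or_gt N 5 with hN | hN
  · have hl := hlog 37 23 5 (by norm_num) (by norm_num) (by norm_num) (by omega)
    norm_num at hl
    have hNr : (N : ℝ) ≤ 5 := by exact_mod_cast hN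
    exact hasThreshold_of_box 5 5 1 2.413 2.587 1.206 1.294 1 0.631 2.237 (by omega) (by omega)
      (by linarith) (by linarith) (by linarith) (by linarith) (by norm_num) (by norm_num)
      (by norm_num) (by norm_num) (by norm_num [Finset.prod_range_succ, Nat.factorial])
  rcases le_or_gt N 6 with hN | hN
  · have hl := hlog 43 24 6 (by norm_num) (by norm_num) (by norm_num) (by omega)
    norm_num at hl
    have hNr : (N : ℝ) ≤ 6 := by exact_mod_cast hN
    exact hasThreshold_of_box 6 6 2 2.687 3.313 1.343 1.657 0.765 0.814 2.45 (by omega) (by omega)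
      (by linarith) (by linarith) (by linarith) (by linarith) (by norm_num) (by norm_num)
      (by norm_num) (by norm_num) (by norm_num [Finset.prod_range_succ, Nat.factorial])
  rcases le_or_gt N 8 with hN | hN
  · have hl := hlog 35 18 7 (by norm_num) (by norm_num) (by norm_num) (by omega)
    norm_num at hl
    have hNr : (N : ℝ) ≤ 8 := by exact_mod_cast hN
    rcases le_total ℓ 3.46 with h | h
    · exact hasThreshold_of_box 7 8 2 2.916 3.46 1.458 2.542 0.94 0.689 2.829 (by omega) (by omega)
        (by linarith) (by linarith) (by linarith) (by linarith) (by norm_num) (by norm_num)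
        (by norm_num) (by norm_num) (by norm_num [Finset.prod_range_succ, Nat.factorial])
    · exact hasThreshold_of_box 7 8 3 3.46 4.54 1.73 2.27 0.685 0.896 2.829 (by omega) (by omega)
        (by linarith) (by linarith) (by linarith) (by linarith) (by norm_num) (by norm_num)
        (by norm_num) (by norm_num) (by norm_num [Finset.prod_range_succ, Nat.factorial])
  rcases le_or_gt N 10 with hN | hN
  · have hl := hlog 46 21 9 (by norm_num) (by norm_num) (by norm_num) (by omega)
    norm_num at hl
    have hNr : (N : ℝ) ≤ 10 := by exact_mod_cast hN
    rcases le_total ℓ 3.83 with h | h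
    · rcases le_total ℓ 3.49 with h | h
      · rcases le_total w 2.5 with h | h
        · exact hasThreshold_of_box 9 10 2 3.285 3.49 1.642 2.5 1 0.61 3.163 (by omega) (by omega)
            (by linarith) (by linarith) (by linarith) (by linarith) (by norm_num) (by norm_num)
            (by norm_num) (by norm_num) (by norm_num [Finset.prod_range_succ, Nat.factorial])
        · exact hasThreshold_of_box 9 10 3 3.285 3.49 2.5 3.358 0.71 0.905 3.163 (by omega)
            (by omega) (by linarith) (by linarith) (by linarith) (by linarith) (by norm_num)
            (by norm_num) (by norm_num) (by norm_num)
            (by norm_num [Finset.prod_range_succ, Nat.factorial])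
      · exact hasThreshold_of_box 9 10 3 3.49 3.83 1.745 3.255 0.705 0.898 3.163 (by omega)
          (by omega) (by linarith) (by linarith) (by linarith) (by linarith) (by norm_num)
          (by norm_num) (by norm_num) (by norm_num)
          (by norm_num [Finset.prod_range_succ, Nat.factorial])
    · exact hasThreshold_of_box 9 10 3 3.83 5.413 1.915 3.085 0.91 0.678 3.163 (by omega) (by omega)
        (by linarith) (by linarith) (by linarith) (by linarith) (by norm_num) (by norm_num)
        (by norm_num) (by norm_num) (by norm_num [Finset.prod_range_succ, Nat.factorial])
  rcases le_or_gt N 12 with hN | hN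
  · have hl := hlog 55 23 11 (by norm_num) (by norm_num) (by norm_num) (by omega)
    norm_num at hl
    have hNr : (N : ℝ) ≤ 12 := by exact_mod_cast hN
    rcases le_total ℓ 3.82 with h | h
    · exact hasThreshold_of_box 11 12 3 3.586 3.82 1.793 4.207 0.765 0.84 3.465 (by omega)
        (by omega) (by linarith) (by linarith) (by linarith) (by linarith) (by norm_num)
        (by norm_num) (by norm_num) (by norm_num)
        (by norm_num [Finset.prod_range_succ, Nat.factorial])
    · rcases le_total ℓ 4.22 with h | h
      · exact hasThreshold_of_box 11 12 3 3.82 4.22 1.91 4.09 0.905 0.701 3.465 (by omega)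
          (by omega) (by linarith) (by linarith) (by linarith) (by linarith) (by norm_num)
          (by norm_num) (by norm_num) (by norm_num)
          (by norm_num [Finset.prod_range_succ, Nat.factorial])
      · exact hasThreshold_of_box 11 12 3 4.22 5.384 2.11 3.89 1 0.619 3.465 (by omega) (by omega)
          (by linarith) (by linarith) (by linarith) (by linarith) (by norm_num) (by norm_num)
          (by norm_num) (by norm_num) (by norm_num [Finset.prod_range_succ, Nat.factorial])
  rcases le_or_gt N 18 with hN | hN
  · have hl := hlog 41 16 13 (by norm_num) (by norm_num) (by norm_num) (by omega)
    norm_num at hl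
    have hNr : (N : ℝ) ≤ 18 := by exact_mod_cast hN
    rcases le_total ℓ 4.04 with h | h
    · rcases le_total w 4.5 with h | h
      · exact hasThreshold_of_box 13 18 3 3.843 4.04 1.921 4.5 0.915 0.693 4.243 (by omega)
          (by omega) (by linarith) (by linarith) (by linarith) (by linarith) (by norm_num)
          (by norm_num) (by norm_num) (by norm_num)
          (by norm_num [Finset.prod_range_succ, Nat.factorial])
      · exact hasThreshold_of_box 13 18 4 3.843 4.04 4.5 7.079 0.74 0.906 4.243 (by omega)
          (by omega) (by linarith) (by linarith) (by linarith) (by linarith) (by norm_num)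
          (by norm_num) (by norm_num) (by norm_num)
          (by norm_num [Finset.prod_range_succ, Nat.factorial])
    · rcases le_total ℓ 4.55 with h | h
      · rcases le_total w 3.88 with h | h
        · exact hasThreshold_of_box 13 18 3 4.04 4.55 2.02 3.88 1 0.615 4.243 (by omega) (by omega)
            (by linarith) (by linarith) (by linarith) (by linarith) (by norm_num) (by norm_num)
            (by norm_num) (by norm_num) (by norm_num [Finset.prod_range_succ, Nat.factorial])
        · exact hasThreshold_of_box 13 18 4 4.04 4.55 3.88 6.98 0.75 0.888 4.243 (by omega)
            (by omega) (by linarith) (by linarith) (by linarith) (by linarith) (by norm_num)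
            (by norm_num) (by norm_num) (by norm_num)
            (by norm_num [Finset.prod_range_succ, Nat.factorial])
      · exact hasThreshold_of_box 13 18 4 4.55 5.359 2.275 6.725 0.8 0.817 4.243 (by omega)
          (by omega) (by linarith) (by linarith) (by linarith) (by linarith) (by norm_num)
          (by norm_num) (by norm_num) (by norm_num)
          (by norm_num [Finset.prod_range_succ, Nat.factorial])
  rcases le_or_gt N 23 with hN | hN
  · have hl := hlog 50 17 19 (by norm_num) (by norm_num) (by norm_num) (by omega)
    norm_num at hl
    have hNr : (N : ℝ) ≤ 23 := by exact_mod_cast hN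
    rcases le_total w 4.6 with h | h
    · exact hasThreshold_of_box 19 23 4 4.411 5.37 2.205 4.6 0.73 0.834 4.796 (by omega) (by omega)
        (by linarith) (by linarith) (by linarith) (by linarith) (by norm_num) (by norm_num)
        (by norm_num) (by norm_num) (by norm_num [Finset.prod_range_succ, Nat.factorial])
    · exact hasThreshold_of_box 19 23 4 4.411 5.01 4.6 8.594 0.87 0.758 4.796 (by omega) (by omega)
        (by linarith) (by linarith) (by linarith) (by linarith) (by norm_num) (by norm_num)
        (by norm_num) (by norm_num) (by norm_num [Finset.prod_range_succ, Nat.factorial])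
  have hl := hlog 54 17 24 (by norm_num) (by norm_num) (by norm_num) (by omega)
  norm_num at hl
  have hNr : (N : ℝ) ≤ 34 := by exact_mod_cast hN34
  exact hasThreshold_of_box 24 34 4 4.764 5.343 2.382 6.24 0.9 0.693 5.832 (by omega) (by omega)
    (by linarith) (by linarith) (by linarith) (by linarith) (by norm_num) (by norm_num)
    (by norm_num) (by norm_num) (by norm_num [Finset.prod_range_succ, Nat.factorial])

lemma hasThreshold {N : ℕ} {ℓ w : ℝ} (hN3 : 3 ≤ N) (hℓ : 3 / 2 * Real.log N ≤ ℓ)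
    (hw : ℓ ≤ 2 * w) (hx : ℓ + 2 * w ≤ N) : HasThreshold N ℓ w := by
  have hlog : 0 ≤ Real.log N := Real.log_natCast_nonneg N
  rcases le_or_gt 5.7 (ℓ + 3 / 20 * w) with h | h
  · exact hasThreshold_of_large hℓ hw hx h (by linarith)
  · exact hasThreshold_of_small hN3 hℓ hw hx h

/-! ### The bound on the expected sine -/

section Bound

variable {N : ℕ} (G : SimpleGraph (Fin N))

open Classical in
lemma choose_mul_pow_le_tailBound (hN : 0 < N) {q ℓ : ℝ} (hq : 0 ≤ q)
    (hqℓ : q * lapEigenvalue G ⟨N - 1, by omega⟩ ≤ 2 / 25 * ℓ) (k : ℕ) {e : Sym2 (Fin N)}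
    (he : e ∈ G.edgeFinset) :
    ((adjacentEdges G.edgeFinset e).card.choose k : ℝ) * q ^ k ≤ tailBound N k ℓ := by
  set z := lapEigenvalue G ⟨N - 1, by omega⟩ with hz
  have hN' : (0 : ℝ) < N := by exact_mod_cast hN
  have hzN : z ≤ N := lapEigenvalue_le G _
  have hz0 : 0 ≤ z := lapEigenvalue_nonneg G _
  have hn : ((adjacentEdges G.edgeFinset e).card : ℝ) ≤ 2 * z - 4 := by
    induction e with
    | h i j =>
      have hij : G.Adj i j := by simpa using he
      have h1 := card_adjacentEdges G (F := G.edgeFinset) (by simp) hij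
      have h2 := degree_add_one_le G hN (i := i) ((G.degree_pos_iff_exists_adj i).mpr ⟨j, hij⟩)
      have h3 := degree_add_one_le G hN (i := j) ((G.degree_pos_iff_exists_adj j).mpr ⟨i, hij.symm⟩)
      have h4 : ((adjacentEdges G.edgeFinset s(i, j)).card : ℝ) + 2 = G.degree i + G.degree j := by
        exact_mod_cast h1
      linarith
  set n := (adjacentEdges G.edgeFinset e).card
  have hfac : (0 : ℝ) < k.factorial := by positivity
  have h1 : (n.choose k : ℝ) = (∏ j ∈ Finset.range k, ((n - j : ℕ) : ℝ)) / k.factorial := by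
    rw [eq_div_iff hfac.ne', mul_comm]
    have := Nat.descFactorial_eq_factorial_mul_choose n k
    rw [Nat.descFactorial_eq_prod_range] at this
    exact_mod_cast this.symm
  have h2 : q ^ k = ∏ j ∈ Finset.range k, q := by simp
  rw [h1, h2, div_mul_eq_mul_div, ← Finset.prod_mul_distrib, tailBound]
  have h3 : 0 ≤ ℓ := by nlinarith [mul_nonneg hq hz0]
  refine div_le_div_of_nonneg_right (Finset.prod_le_prod (fun j _ => by positivity)
    fun j _ => ?_) hfac.le
  rcases le_total n j with hnj | hnj
  · rw [Nat.sub_eq_zero_of_le hnj]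
    simp only [Nat.cast_zero, zero_mul]
    positivity
  · rw [Nat.cast_sub hnj]
    have hj : (j : ℝ) ≤ n := by exact_mod_cast hnj
    have hfrac : (4 + j : ℝ) / (2 * N) ≤ 1 := by
      rw [div_le_one (by positivity)]
      linarith
    have h5 : q * z * ((4 + j : ℝ) / N) ≤ q * (4 + j) := by
      rw [mul_assoc]
      refine mul_le_mul_of_nonneg_left ?_ hq
      rw [mul_div_assoc', div_le_iff₀ hN', mul_comm]
      exact mul_le_mul_of_nonneg_left hzN (by positivity)
    calc ((n : ℝ) - j) * q ≤ (2 * z - 4 - j) * q := by gcongr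
      _ = 2 * (q * z) - q * (4 + j) := by ring
      _ ≤ 2 * (q * z) - q * z * ((4 + j : ℝ) / N) := by linarith
      _ = 2 * (q * z) * (1 - (4 + j) / (2 * N)) := by field_simp
      _ ≤ 4 / 25 * ℓ * (1 - (4 + j) / (2 * N)) := by
          refine mul_le_mul_of_nonneg_right ?_ (by linarith)
          linarith
      _ ≤ _ := by gcongr; exact le_max_right _ _

open Classical in
/-- Cauchy–Schwarz for the degree sequence. -/
lemma two_mul_card_edges_le :
    2 * (G.edgeFinset.card : ℝ) ≤ √(∑ i, (G.degree i : ℝ) ^ 2) * √N := by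
  rw [← Real.sqrt_mul (by positivity)]
  refine Real.le_sqrt_of_sq_le ?_
  have h1 := sq_sum_le_card_mul_sum_sq (s := Finset.univ) (f := fun i => (G.degree i : ℝ))
  have h2 : ∑ i, (G.degree i : ℝ) = 2 * (G.edgeFinset.card : ℝ) := by
    exact_mod_cast G.sum_degrees_eq_twice_card_edges
  rw [h2, Finset.card_univ, Fintype.card_fin] at h1
  linarith

/-- The deterministic estimates behind the bound: `hmain` bounds the contribution of the linear term
and `htail` that of the tail. -/
lemma sqrt_le_and_tail_le {N m D y g t T ℓ w : ℝ} (hN' : 3 ≤ N) (hm0 : 0 ≤ m) (hD0 : 0 ≤ D)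
    (hg0 : 0 ≤ g) (hg1 : g ≤ 1) (ht0 : 0 ≤ t) (hT0 : 0 ≤ T) (hy0 : 0 ≤ y) (hyw : y ≤ w)
    (hmain : N * w ≤ t ^ 2 * g ^ 2 * (w + (N - 2) * (ℓ + 2 * w)))
    (htail : t + w * √N / 2 * T ≤ 1) (htrace : y + (N - 2) * (ℓ + 2 * w) ≤ 2 * m)
    (hmD : 2 * m ≤ D * √N) :
    √(2 * m * y) ≤ t * g * D ∧ m * T * y ≤ (1 - t) * D := by
  have hw0 : 0 ≤ w := hy0.trans hyw
  have hc0 : 0 ≤ t ^ 2 * g ^ 2 := by positivity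
  have ht1 : t ≤ 1 := by
    have : 0 ≤ w * √N / 2 * T := by positivity
    linarith
  have hc1 : t ^ 2 * g ^ 2 ≤ 1 := by
    rw [← mul_pow]
    exact pow_le_one₀ (by positivity) (mul_le_one₀ ht1 hg0 hg1)
  have hNy : N * y ≤ t ^ 2 * g ^ 2 * (2 * m) := by
    have h1 : N * y ≤ t ^ 2 * g ^ 2 * (y + (N - 2) * (ℓ + 2 * w)) := by
      nlinarith [mul_nonneg (sub_nonneg.mpr hyw) (show 0 ≤ N - t ^ 2 * g ^ 2 by linarith)]
    exact h1.trans (mul_le_mul_of_nonneg_left htrace hc0)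
  have hfirst : √(2 * m * y) ≤ t * g * D := by
    rw [Real.sqrt_le_left (by positivity)]
    have h1 : (2 * m) ^ 2 ≤ D ^ 2 * N := by
      calc (2 * m) ^ 2 ≤ (D * √N) ^ 2 := by gcongr
        _ = D ^ 2 * N := by rw [mul_pow, Real.sq_sqrt (by positivity)]
    have h2 : N * (2 * m * y) ≤ N * (t * g * D) ^ 2 := by
      calc N * (2 * m * y) = 2 * m * (N * y) := by ring
        _ ≤ 2 * m * (t ^ 2 * g ^ 2 * (2 * m)) := by gcongr
        _ = t ^ 2 * g ^ 2 * (2 * m) ^ 2 := by ring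
        _ ≤ t ^ 2 * g ^ 2 * (D ^ 2 * N) := by gcongr
        _ = _ := by ring
    exact le_of_mul_le_mul_left h2 (by linarith)
  have hsecond : m * T * y ≤ (1 - t) * D := by
    calc m * T * y ≤ (D * √N / 2) * T * w := by
          gcongr
          linarith
      _ = (w * √N / 2 * T) * D := by ring
      _ ≤ (1 - t) * D := by gcongr; linarith
  exact ⟨hfirst, hsecond⟩

open Classical in
/-- The expected sine is at most `q * √(∑ dᵢ²) / λ₂`. -/
lemma expectedSinAngle_le_of_gap (hN : 3 ≤ N) {q ε : ℝ} (hq0 : 0 ≤ q) (hq1 : q ≤ 1)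
    {u : SimpleGraph (Fin N) → EuclideanSpace ℝ (Fin N)}
    (hu : ∀ H, IsSecondEigenvector hN H (u H)) (hε : 2 ≤ ε)
    (h01 : 0 < lapEigenvalue G ⟨1, by omega⟩)
    (hgap : 2 * ε / (ε - 1) * lapEigenvalue G ⟨1, by omega⟩ < lapEigenvalue G ⟨2, by omega⟩)
    (hmax : max (25 / 2 * ε * q * lapEigenvalue G ⟨N - 1, by omega⟩) (3 / 2 * ε * Real.log N)
      ≤ lapEigenvalue G ⟨2, by omega⟩) :
    expectedSinAngle G q u ≤
      q * √(∑ i, (G.degree i : ℝ) ^ 2) / lapEigenvalue G ⟨1, by omega⟩ := by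
  set x := lapEigenvalue G ⟨2, by omega⟩ with hx
  set y := lapEigenvalue G ⟨1, by omega⟩ with hy
  set D := √(∑ i, (G.degree i : ℝ) ^ 2) with hD
  set m : ℝ := (G.edgeFinset.card : ℝ) with hm
  obtain ⟨hqz, hlog⟩ := max_le_iff.mp hmax
  have hε0 : 0 < ε := by linarith
  have hN' : (3 : ℝ) ≤ N := by exact_mod_cast hN
  have hxN : x ≤ N := lapEigenvalue_le G _
  have hx0 : 0 ≤ x := lapEigenvalue_nonneg G _
  set ℓ := x / ε with hℓ
  set w := (x - ℓ) / 2 with hw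
  have hxℓ : x = ε * ℓ := by rw [hℓ]; field_simp
  have hℓ0 : 0 ≤ ℓ := by positivity
  have hxw : x = ℓ + 2 * w := by rw [hw]; ring
  have hyw : y ≤ w := by
    have h1 : 0 < ε - 1 := by linarith
    rw [div_mul_eq_mul_div, div_lt_iff₀ h1] at hgap
    have h2 : ε * (2 * y) ≤ ε * (x - ℓ) := by rw [mul_sub, ← hxℓ]; linarith
    have := le_of_mul_le_mul_left h2 hε0
    rw [hw]; linarith
  have hw0 : 0 ≤ w := by linarith
  obtain ⟨k, g, t, hg0, hg1, ht0, hk, hmain, htail⟩ := hasThreshold (N := N) (ℓ := ℓ) (w := w) hN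
    (by rw [hℓ, le_div_iff₀ hε0]; linarith)
    (by rw [hw]; nlinarith) (by rw [← hxw]; exact hxN)
  have htail0 : 0 ≤ tailBound N k ℓ := tailBound_nonneg hℓ0
  set T := tailBound N k ℓ with hT
  have hE := expectedSinAngle_le G hN hq0 hq1 hu (k := k) hg0 hg1 h01 (by
    rw [← hx, ← hy]
    nlinarith)
  have hqℓ : q * lapEigenvalue G ⟨N - 1, by omega⟩ ≤ 2 / 25 * ℓ := by
    rw [hℓ, mul_div_assoc', le_div_iff₀ hε0]
    linarith
  have hsum : ∑ e ∈ G.edgeFinset,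
      ((adjacentEdges G.edgeFinset e).card.choose k : ℝ) * q ^ (k + 1) ≤
      q * (m * T) := by
    have : ∀ e ∈ G.edgeFinset, ((adjacentEdges G.edgeFinset e).card.choose k : ℝ) * q ^ (k + 1) ≤
        q * T := by
      intro e he
      rw [pow_succ, ← mul_assoc, mul_comm]
      exact mul_le_mul_of_nonneg_left
        (choose_mul_pow_le_tailBound G (by omega) hq0 hqℓ k he) hq0
    refine (Finset.sum_le_sum this).trans (le_of_eq ?_)
    rw [Finset.sum_const, nsmul_eq_mul]
    ring
  have hmD : 2 * m ≤ D * √N := two_mul_card_edges_le G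
  have hm0 : 0 ≤ m := Nat.cast_nonneg _
  have hD0 : 0 ≤ D := Real.sqrt_nonneg _
  have htrace : y + (N - 2) * x ≤ 2 * m := lapEigenvalue_two_three_le G (by omega)
  rw [hxw] at htrace
  have hE' : expectedSinAngle G q u ≤ q * (√(2 * m * y) / (g * y)) + q * (m * T) :=
    hE.trans (add_le_add le_rfl hsum)
  obtain ⟨hfirst, hsecond⟩ := sqrt_le_and_tail_le (by linarith) hm0 hD0 hg0.le hg1 ht0 htail0
    h01.le hyw hmain htail htrace hmD
  clear_value m D T
  calc expectedSinAngle G q u ≤ q * (√(2 * m * y) / (g * y)) + q * (m * T) := hE'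
    _ ≤ q * (t * g * D / (g * y)) + q * ((1 - t) * D / y) := by
        gcongr
        rw [le_div_iff₀ h01]
        exact hsecond
    _ = q * D / y := by
        field_simp
        ring

lemma expectedSinAngle_zero {u : SimpleGraph (Fin N) → EuclideanSpace ℝ (Fin N)}
    (hu : u G ≠ 0) : expectedSinAngle G 0 u = 0 := by
  classical
  unfold expectedSinAngle noisyExpectation
  refine Finset.sum_eq_zero fun F _ => ?_
  rcases F.eq_empty_or_nonempty with rfl | hF
  · simp [InnerProductGeometry.angle_self hu]
  · rw [zero_pow hF.card_pos.ne']
    ring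

lemma expectedSinAngle_nonneg {q : ℝ} (hq0 : 0 ≤ q) (hq1 : q ≤ 1)
    (u : SimpleGraph (Fin N) → EuclideanSpace ℝ (Fin N)) : 0 ≤ expectedSinAngle G q u := by
  classical
  unfold expectedSinAngle noisyExpectation
  exact Finset.sum_nonneg fun F _ => mul_nonneg (deletionWeight_nonneg hq0 hq1 F)
    (InnerProductGeometry.sin_angle_nonneg _ _)

/-- The quantitative form of both claims: slack `δ` in the exponent `β` is a gain `N ^ (-δ)`. -/
lemma expectedSinAngle_le_rpow (hN : 3 ≤ N) {q χ φ β κ δ : ℝ} (hq0 : 0 ≤ q) (hq1 : q ≤ 1)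
    {u : SimpleGraph (Fin N) → EuclideanSpace ℝ (Fin N)}
    (hu : ∀ H, IsSecondEigenvector hN H (u H)) (h : SpectralGapSmallNoise hN G q χ φ β κ)
    (hβ : 1 / 2 * max χ φ + δ ≤ β) :
    expectedSinAngle G q u ≤ (N : ℝ) ^ (-δ) / κ := by
  classical
  obtain ⟨hχ, -, ⟨ε, hε, hgap, hmax⟩, hq, -, hκ⟩ := h
  have hN0 : (0 : ℝ) < N := by
    have : 0 < N := by omega
    exact_mod_cast this
  have hN1 : (1 : ℝ) ≤ N := by
    have : 1 ≤ N := by omega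
    exact_mod_cast this
  have hκ0 : 0 < κ := by linarith
  rcases hq0.eq_or_lt with rfl | hqpos
  · rw [expectedSinAngle_zero]
    · positivity
    · intro h0
      have := (hu G).1
      rw [h0] at this
      simp at this
  set y := lapEigenvalue G ⟨1, by omega⟩ with hy
  have hden : 0 < κ * (N : ℝ) ^ β := by positivity
  rw [le_div_iff₀ hden] at hq
  have hy0 : 0 < y := lt_of_lt_of_le (by positivity) hq
  refine (expectedSinAngle_le_of_gap G hN hq0 hq1 hu hε hy0 hgap hmax).trans ?_
  have hD : √(∑ i, (G.degree i : ℝ) ^ 2) = (N : ℝ) ^ (χ / 2) := by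
    have h1 : ∑ i, (G.degree i : ℝ) ^ 2 = (N : ℝ) ^ χ := by convert hχ
    rw [h1, Real.sqrt_eq_rpow, ← Real.rpow_mul hN0.le]
    ring_nf
  rw [hD, div_le_div_iff₀ hy0 hκ0]
  have h2 : (N : ℝ) ^ (χ / 2) ≤ (N : ℝ) ^ (-δ) * (N : ℝ) ^ β := by
    rw [← Real.rpow_add hN0]
    refine Real.rpow_le_rpow_of_exponent_le hN1 ?_
    have := le_max_left χ φ
    linarith
  calc q * (N : ℝ) ^ (χ / 2) * κ ≤ q * ((N : ℝ) ^ (-δ) * (N : ℝ) ^ β) * κ := by gcongr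
    _ = (N : ℝ) ^ (-δ) * (q * (κ * (N : ℝ) ^ β)) := by ring
    _ ≤ (N : ℝ) ^ (-δ) * y := by gcongr

end Bound

theorem proposition4p1 :
    (∀ (N : ℕ) (hN : 3 ≤ N) (G : SimpleGraph (Fin N)) (q χ φ β κ : ℝ)
      (u : SimpleGraph (Fin N) → EuclideanSpace ℝ (Fin N)),
      0 ≤ q → q ≤ 1 →
      (∀ H, IsSecondEigenvector hN H (u H)) →
      SpectralGapSmallNoise hN G q χ φ β κ →
      expectedSinAngle G q u ≤ 1 / κ) ∧
    (∀ (N : ℕ → ℕ) (hN : ∀ n, 3 ≤ N n) (G : ∀ n, SimpleGraph (Fin (N n)))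
      (q χ φ β κ : ℕ → ℝ) (δ : ℝ)
      (u : ∀ n, SimpleGraph (Fin (N n)) → EuclideanSpace ℝ (Fin (N n))),
      Tendsto N atTop atTop →
      (∀ n, 0 ≤ q n) → (∀ n, q n ≤ 1) →
      (∀ n H, IsSecondEigenvector (hN n) H (u n H)) →
      (∀ n, SpectralGapSmallNoise (hN n) (G n) (q n) (χ n) (φ n) (β n) (κ n)) →
      0 < δ → (∀ n, 1 / 2 * max (χ n) (φ n) + δ ≤ β n) →
      Tendsto (fun n => expectedSinAngle (G n) (q n) (u n)) atTop (𝓝 0)) := by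
  refine ⟨fun N hN G q χ φ β κ u hq0 hq1 hu h => ?_,
    fun N hN G q χ φ β κ δ u hNtop hq0 hq1 hu h hδ hβ => ?_⟩
  · have := expectedSinAngle_le_rpow G hN (δ := 0) hq0 hq1 hu h
      (by have h5 := h.2.2.2.2.1; linarith)
    rwa [neg_zero, Real.rpow_zero] at this
  · refine squeeze_zero (fun n => expectedSinAngle_nonneg (G n) (hq0 n) (hq1 n) (u n))
      (fun n => ?_) ((tendsto_rpow_neg_atTop hδ).comp (tendsto_natCast_atTop_atTop.comp hNtop))
    refine (expectedSinAngle_le_rpow (G n) (hN n) (hq0 n) (hq1 n) (hu n) (h n) (hβ n)).trans ?_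
    exact div_le_self (by positivity) (h n).2.2.2.2.2.le
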